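/- Let $(M,\omega)$ be a compact symplectic manifold of dimension $2n$ with a prequantum line bundle $L$ (a Hermitian line bundle with compatible connection of curvature $-i\omega$), and let $(I_\sigma)_{\sigma\in\mathcal T}$ be a smooth family of Kähler structures on $M$ compatible with $\omega$, parametrized by a smooth manifold $\mathcal T$ (Hausdorff, second countable, finite-dimensional). For $\sigma\in\mathcal T$ let $\star_\sigma$ be the Berezin–Toeplitz star product of $(M,\omega,I_\sigma)$: the star product $f\star_\sigma g=\sum_{l\ge 0}c^l_\sigma(f,g)h^l$ on $C_h^\infty(M)=C^\infty(M)[[h]]$ such that, for all $f,g\in C^\infty(M)$ and all $N\ge 1$, $$\Bigl\|T^{(k)}_{f}T^{(k)}_{g}-\sum_{l=0}^{N}k^{-l}\,T^{(k)}_{c^l_\sigma(f,g)}\Bigr\|=O(k^{-(N+1)})\qquad(k\to\infty),$$ where $T^{(k)}_f s=\pi^{(k)}(fs)$ is the Toeplitz operator on $H^0(M_\sigma;L^k)$, $\pi^{(k)}$ is the $L^2$-orthogonal projection onto holomorphic sections and the norm is the operator norm on $H^0(M_\sigma;L^k)$. A formal connection is an operator $D_Vf=V[f]+A(V)(f)$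 on smooth sections $f$ of $\mathcal T\times C_h^\infty(M)\to\mathcal T$, for $V$ a smooth vector field on $\mathcal T$, where $A=\sum_{k\ge1}A^kh^k$ and each $A^k$ is a smooth $1$-form on $\mathcal T$ with values in differential operators on $M$. A formal Hitchin connection is a formal connection that is flat ($D_VD_W-D_WD_V-D_{[V,W]}=0$) and compatible with the family $(\star_\sigma)$, i.e. for all smooth sections $f,g$ the product $f\star_\sigma g$ is again a smooth section and $D_V(f\star_\sigma g)=D_V(f)\star_\sigma g+f\star_\sigma D_V(g)$. Suppose that $H^1(\mathcal T,\mathbb R)=0$. Then a formal Hitchin connection is unique up to gauge equivalence: for any two formal Hitchin connections $D,D'$ there is a smooth map $P=\sum_{k\ge0}P_kh^k$ from $\mathcal T$ to formal differential operators on $M$ with $P_0=\mathrm{id}$ and $P_\sigma(f\star_\sigma g)=P_\sigma(f)\star_\sigma P_\sigma(g)$ for all $\sigma\in\mathcal T$ and $f,g\in C_h^\infty(M)$, such that $D'_V=P^{-1}D_VP$ for every smooth vector field $V$ on $\mathcal T$. -/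

import Mathlib

open scoped Manifold ContDiff Topology
open Filter MeasureTheory

namespace FormalHitchin

noncomputable section

/-! ### Vector fields and first de Rham cohomology -/

section Forms

variable (E : Type*) [NormedAddCommGroup E] [NormedSpace ℝ E]
  (N : Type*) [TopologicalSpace N] [ChartedSpace E N]

/-- Smooth real vector fields on a manifold `N` modelled on `E`. -/
structure SmoothVectorField [IsManifold 𝓘(ℝ, E) ∞ N] where
  toFun : ∀ x : N, TangentSpace 𝓘(ℝ, E) x
  smooth : ContMDiff 𝓘(ℝ, E) 𝓘(ℝ, E).tangent ∞
    (fun x : N => (⟨x, toFun x⟩ : TangentBundle 𝓘(ℝ, E) N))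

instance [IsManifold 𝓘(ℝ, E) ∞ N] : CoeFun (SmoothVectorField E N)
    (fun _ => ∀ x : N, TangentSpace 𝓘(ℝ, E) x) := ⟨SmoothVectorField.toFun⟩

/-- The Lie bracket of two smooth vector fields. -/
def SmoothVectorField.bracket {E : Type*} [NormedAddCommGroup E] [NormedSpace ℝ E]
    [FiniteDimensional ℝ E] {N : Type*} [TopologicalSpace N] [ChartedSpace E N]
    [IsManifold 𝓘(ℝ, E) ∞ N] (V W : SmoothVectorField E N) : SmoothVectorField E N where
  toFun := VectorField.mlieBracket 𝓘(ℝ, E) V W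
  smooth := by
    have : CompleteSpace E := FiniteDimensional.complete ℝ E
    have : IsManifold 𝓘(ℝ, E) (((⊤ : ℕ∞) : WithTop ℕ∞) + 1) N := by
      simpa using (inferInstance : IsManifold 𝓘(ℝ, E) ∞ N)
    have : IsManifold 𝓘(ℝ, E) (minSmoothness ℝ 2) N := by
      simpa using IsManifold.of_le (m := 2) (n := ∞) (I := 𝓘(ℝ, E)) (M := N) (WithTop.coe_le_coe.2 le_top)
    have : IsManifold 𝓘(ℝ, E) (minSmoothness ℝ 3) N := by
      simpa using IsManifold.of_le (m := 3) (n := ∞) (I := 𝓘(ℝ, E)) (M := N) (WithTop.coe_le_coe.2 le_top)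
    exact ContDiff.mlieBracket_vectorField (m := ⊤) (n := ⊤) V.smooth W.smooth (by simp)

/-- Families of covectors, one at every point of `N` (no regularity). -/
def CovectorFamily := ∀ x : N, TangentSpace 𝓘(ℝ, E) x →L[ℝ] ℝ

instance : AddCommGroup (CovectorFamily E N) :=
  inferInstanceAs (AddCommGroup (∀ x : N, TangentSpace 𝓘(ℝ, E) x →L[ℝ] ℝ))

instance : Module ℝ (CovectorFamily E N) :=
  inferInstanceAs (Module ℝ (∀ x : N, TangentSpace 𝓘(ℝ, E) x →L[ℝ] ℝ))

variable {E N} in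
theorem CovectorFamily.add_apply (α β : CovectorFamily E N) (x : N) (v : TangentSpace 𝓘(ℝ, E) x) :
    (α + β) x v = α x v + β x v := rfl

variable {E N} in
theorem CovectorFamily.smul_apply (c : ℝ) (α : CovectorFamily E N) (x : N)
    (v : TangentSpace 𝓘(ℝ, E) x) : (c • α) x v = c * α x v := rfl

variable {E N} in
theorem CovectorFamily.zero_apply (x : N) (v : TangentSpace 𝓘(ℝ, E) x) :
    (0 : CovectorFamily E N) x v = 0 := rfl

variable [IsManifold 𝓘(ℝ, E) ∞ N]

variable {E N} in
/-- `α` is a smooth `1`-form: `α(V)` is a smooth function for every smooth vector field `V`. -/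
def IsSmoothForm (α : CovectorFamily E N) : Prop :=
  ∀ V : SmoothVectorField E N, ContMDiff 𝓘(ℝ, E) 𝓘(ℝ, ℝ) ∞ (fun x => α x (V x))

variable {E N} in
/-- `dα = 0`, where `dα(V, W) = V[α(W)] - W[α(V)] - α([V, W])`. -/
def IsClosedForm (α : CovectorFamily E N) : Prop :=
  ∀ (V W : SmoothVectorField E N) (x : N),
    mvfderiv 𝓘(ℝ, E) (fun y => α y (W y)) x (V x) - mvfderiv 𝓘(ℝ, E) (fun y => α y (V y)) x (W x)
      - α x (VectorField.mlieBracket 𝓘(ℝ, E) V W x) = 0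

/-- The space `Z¹` of smooth closed `1`-forms. -/
def closedForms : Submodule ℝ (CovectorFamily E N) where
  carrier := {α | IsSmoothForm α ∧ IsClosedForm α}
  zero_mem' := by
    refine ⟨fun V => ?_, fun V W x => ?_⟩
    · simpa [CovectorFamily.zero_apply] using contMDiff_const
    · simp [CovectorFamily.zero_apply, mvfderiv_const]
  add_mem' := by
    rintro α β ⟨ha, ha'⟩ ⟨hb, hb'⟩
    refine ⟨fun V => ?_, fun V W x => ?_⟩
    · exact (ha V).add (hb V)
    · have h1 := ha' V W x
      have h2 := hb' V W x
      have e : ∀ V : SmoothVectorField E N, mvfderiv 𝓘(ℝ, E) (fun y => (α + β) y (V y)) x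
          = mvfderiv 𝓘(ℝ, E) (fun y => α y (V y)) x + mvfderiv 𝓘(ℝ, E) (fun y => β y (V y)) x :=
        fun V => mvfderiv_add ((ha V).mdifferentiable (by simp) x)
          ((hb V).mdifferentiable (by simp) x)
      rw [e V, e W]
      simp only [CovectorFamily.add_apply, _root_.add_apply]
      linarith
  smul_mem' := by
    rintro c α ⟨ha, ha'⟩
    refine ⟨fun V => ?_, fun V W x => ?_⟩
    · exact contMDiff_const.mul (ha V)
    · have h1 := ha' V W x
      have e : ∀ V : SmoothVectorField E N, mvfderiv 𝓘(ℝ, E) (fun y => (c • α) y (V y)) x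
          = c • mvfderiv 𝓘(ℝ, E) (fun y => α y (V y)) x := by
        intro V
        have := mvfderiv_mul (I := 𝓘(ℝ, E)) (f := fun _ : N => c) (x := x)
          (g := fun y => α y (V y)) mdifferentiableAt_const
          ((ha V).mdifferentiable (by simp) x)
        rw [mvfderiv_const] at this
        simpa [Pi.mul_def, CovectorFamily.smul_apply] using this
      rw [e V, e W]
      simp only [CovectorFamily.smul_apply, _root_.smul_apply, smul_eq_mul]
      linear_combination c * h1

/-- The space `B¹` of exact `1`-forms `dg`, for `g` a smooth function. -/
def exactForms : Submodule ℝ (CovectorFamily E N) where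
  carrier := {α | ∃ g : N → ℝ, ContMDiff 𝓘(ℝ, E) 𝓘(ℝ, ℝ) ∞ g ∧
    ∀ (x : N) (v : TangentSpace 𝓘(ℝ, E) x), α x v = mvfderiv 𝓘(ℝ, E) g x v}
  zero_mem' := ⟨fun _ => 0, contMDiff_const, fun x v => by
    simp [CovectorFamily.zero_apply, mvfderiv_const]⟩
  add_mem' := by
    rintro α β ⟨g, hg, hg'⟩ ⟨k, hk, hk'⟩
    refine ⟨g + k, hg.add hk, fun x v => ?_⟩
    rw [mvfderiv_add (hg.mdifferentiable (by simp) x) (hk.mdifferentiable (by simp) x)]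
    simp [CovectorFamily.add_apply, hg', hk']
  smul_mem' := by
    rintro c α ⟨g, hg, hg'⟩
    refine ⟨fun x => c * g x, contMDiff_const.mul hg, fun x v => ?_⟩
    have := mvfderiv_mul (I := 𝓘(ℝ, E)) (f := fun _ : N => c) (x := x) (g := g)
      mdifferentiableAt_const (hg.mdifferentiable (by simp) x)
    rw [mvfderiv_const] at this
    have h2 : mvfderiv 𝓘(ℝ, E) (fun x => c * g x) x = c • mvfderiv 𝓘(ℝ, E) g x := by
      simpa [Pi.mul_def] using this
    rw [h2]
    simp [CovectorFamily.smul_apply, hg']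

/-- The first de Rham cohomology group `H¹(N, ℝ) = Z¹ / B¹`. -/
abbrev deRhamH1 : Type _ :=
  closedForms E N ⧸ (exactForms E N).comap (closedForms E N).subtype

end Forms

/-! ### Smooth complex functions, smooth families of them, differential operators -/

section Functions

variable (E : Type*) [NormedAddCommGroup E] [NormedSpace ℝ E]
  (M : Type*) [TopologicalSpace M] [ChartedSpace E M]

/-- `C^∞(M)`: the `ℂ`-algebra of smooth complex-valued functions on `M`. -/
def SmoothFun : Subalgebra ℂ (M → ℂ) where
  carrier := {f | ContMDiff 𝓘(ℝ, E) 𝓘(ℝ, ℂ) ∞ f}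
  mul_mem' := fun {f g} hf hg => by
    exact (contDiff_mul (𝕜 := ℝ) (𝔸 := ℂ)).contMDiff.comp (hf.prodMk_space hg)
  add_mem' := fun {f g} hf hg => hf.add hg
  algebraMap_mem' := fun c => contMDiff_const

/-- Formal functions `C^∞(M)[[h]]`. -/
abbrev FormalFun := PowerSeries (SmoothFun E M)

variable {E M}

/-- Differential operators on `C^∞(M)` of order at most `N`, in the algebraic description: all
`(N + 1)`-fold iterated commutators with multiplication operators vanish. -/
def IsDiffOp : ℕ → Module.End ℂ (SmoothFun E M) → Prop
  | 0, P => ∀ g : SmoothFun E M,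
      P * LinearMap.mulLeft ℂ g - LinearMap.mulLeft ℂ g * P = 0
  | N + 1, P => ∀ g : SmoothFun E M,
      IsDiffOp N (P * LinearMap.mulLeft ℂ g - LinearMap.mulLeft ℂ g * P)

/-- The `ℂ[[h]]`-linear action of a formal operator `∑ P_k h^k` on formal functions. -/
def formalApply (P : ℕ → Module.End ℂ (SmoothFun E M)) (f : FormalFun E M) : FormalFun E M :=
  PowerSeries.mk fun n => ∑ p ∈ Finset.HasAntidiagonal.antidiagonal n, P p.1 (PowerSeries.coeff p.2 f)

/-- The `ℂ[[h]]`-bilinear product on formal functions with coefficients `c k`. -/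
def formalMul (c : ℕ → SmoothFun E M →ₗ[ℂ] SmoothFun E M →ₗ[ℂ] SmoothFun E M)
    (f g : FormalFun E M) : FormalFun E M :=
  PowerSeries.mk fun n => ∑ p ∈ Finset.HasAntidiagonal.antidiagonal n, ∑ q ∈ Finset.HasAntidiagonal.antidiagonal p.2,
    c p.1 (PowerSeries.coeff q.1 f) (PowerSeries.coeff q.2 g)

end Functions

section Families

variable {F : Type*} [NormedAddCommGroup F] [NormedSpace ℝ F]
  {T : Type*} [TopologicalSpace T] [ChartedSpace F T]
  {E : Type*} [NormedAddCommGroup E] [NormedSpace ℝ E]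
  {M : Type*} [TopologicalSpace M] [ChartedSpace E M]

variable (F) in
/-- A smooth map `T → C^∞(M)`, i.e. one for which `(σ, x) ↦ f_σ(x)` is smooth on `T × M`. -/
def IsSmoothFamily (f : T → SmoothFun E M) : Prop :=
  ContMDiff (𝓘(ℝ, F).prod 𝓘(ℝ, E)) 𝓘(ℝ, ℂ) ∞ (fun p : T × M => (f p.1 : M → ℂ) p.2)

theorem isSmoothFamily_add {f g : T → SmoothFun E M} (hf : IsSmoothFamily F f)
    (hg : IsSmoothFamily F g) : IsSmoothFamily F (fun σ => f σ + g σ) := hf.add hg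

theorem isSmoothFamily_sum {α : Type*} (s : Finset α) {f : α → T → SmoothFun E M}
    (hf : ∀ a ∈ s, IsSmoothFamily F (f a)) : IsSmoothFamily F (fun σ => ∑ a ∈ s, f a σ) := by
  classical
  induction s using Finset.induction_on with
  | empty => simpa [IsSmoothFamily] using contMDiff_const
  | insert a s ha ih =>
    simp only [Finset.sum_insert ha]
    exact isSmoothFamily_add (hf a (by simp)) (ih fun b hb => hf b (by simp [hb]))

variable [IsManifold 𝓘(ℝ, F) ∞ T] [IsManifold 𝓘(ℝ, E) ∞ M]

/-- `(σ, x) ↦ V[f]_σ(x)` is smooth on `T × M`, for a smooth map `f : T → C^∞(M)`. -/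
theorem contMDiff_derivAlong (V : SmoothVectorField F T) {f : T → SmoothFun E M}
    (hf : IsSmoothFamily F f) :
    ContMDiff (𝓘(ℝ, F).prod 𝓘(ℝ, E)) 𝓘(ℝ, ℂ) ∞
      (fun p : T × M => mvfderiv 𝓘(ℝ, F) (fun τ => (f τ : M → ℂ) p.2) p.1 (V p.1)) := by
  have S₁ : ContMDiff (𝓘(ℝ, F).prod 𝓘(ℝ, E)) (𝓘(ℝ, F).tangent.prod 𝓘(ℝ, E).tangent) ∞
      (fun p : T × M => ((⟨p.1, V p.1⟩ : TangentBundle 𝓘(ℝ, F) T),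
        (⟨p.2, 0⟩ : TangentBundle 𝓘(ℝ, E) M))) :=
    (V.smooth.comp contMDiff_fst).prodMk
      ((Bundle.contMDiff_zeroSection ℝ (TangentSpace 𝓘(ℝ, E) : M → Type _)).comp contMDiff_snd)
  have S₂ := (contMDiff_equivTangentBundleProd_symm (n := ∞) (I := 𝓘(ℝ, F)) (I' := 𝓘(ℝ, E))
    (M := T) (M' := M)).comp S₁
  have S₃ := (hf.contMDiff_tangentMap (m := ∞) (by simp)).comp S₂
  have S₄ := (contMDiff_snd_tangentBundle_modelSpace ℂ 𝓘(ℝ, ℂ) (n := ∞)).comp S₃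
  convert! S₄ using 1
  ext p
  have hd := hf.mdifferentiable (by simp) p
  have key := mfderiv_prod_eq_add_apply (v := ((V p.1, 0) :
    TangentSpace (𝓘(ℝ, F).prod 𝓘(ℝ, E)) p)) hd
  change (mfderiv 𝓘(ℝ, F) 𝓘(ℝ, ℂ) (fun z => (f z : M → ℂ) p.2) p.1 (V p.1) : ℂ) =
    mfderiv (𝓘(ℝ, F).prod 𝓘(ℝ, E)) 𝓘(ℝ, ℂ) (fun p : T × M => (f p.1 : M → ℂ) p.2) p
      ((V p.1, 0) : TangentSpace (𝓘(ℝ, F).prod 𝓘(ℝ, E)) p)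
  rw [key]
  exact (congrArg (_ + ·) (map_zero _)).trans (add_zero _) |>.symm

/-- The derivative `V[f]` of a smooth map `f : T → C^∞(M)` along a vector field on `T`. -/
def derivAlong (V : SmoothVectorField F T) (f : T → SmoothFun E M) (hf : IsSmoothFamily F f)
    (σ : T) : SmoothFun E M :=
  ⟨fun x => mvfderiv 𝓘(ℝ, F) (fun τ => (f τ : M → ℂ) x) σ (V σ),
    (contMDiff_derivAlong V hf).comp (contMDiff_const.prodMk contMDiff_id)⟩

variable (F T E M) in
/-- Smooth sections of the trivial bundle `T × C^∞(M)[[h]] → T`. -/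
structure FormalSection where
  toFun : T → FormalFun E M
  smooth : ∀ n, IsSmoothFamily F (fun σ => PowerSeries.coeff n (toFun σ))

instance : CoeFun (FormalSection F T E M) (fun _ => T → FormalFun E M) := ⟨FormalSection.toFun⟩

variable (F T E M) in
/-- A formal connection `D_V f = V[f] + A(V)(f)`: here `A = ∑ A^k h^k` is a smooth `1`-form on `T`
with values in formal differential operators on `M` such that `A = 0` modulo `h`.  Smoothness of
`A^k` means that the differential order is bounded locally on `T` and that `A^k(V)(f)` is a smooth
map `T → C^∞(M)` whenever `V` is a smooth vector field on `T` and `f : T → C^∞(M)` is smooth. -/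
structure FormalConnection where
  A : ∀ σ : T, TangentSpace 𝓘(ℝ, F) σ →ₗ[ℝ] (ℕ → Module.End ℂ (SmoothFun E M))
  A_zero : ∀ σ v, A σ v 0 = 0
  isDiffOp : ∀ (k : ℕ) (σ₀ : T), ∃ N : ℕ, ∀ᶠ σ in 𝓝 σ₀, ∀ v, IsDiffOp N (A σ v k)
  smooth : ∀ (k : ℕ) (V : SmoothVectorField F T) (f : T → SmoothFun E M),
    IsSmoothFamily F f → IsSmoothFamily F (fun σ => A σ (V σ) k (f σ))

/-- The covariant derivative `D_V f = V[f] + A(V)(f)` of a smooth section. -/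
def FormalConnection.covDeriv (D : FormalConnection F T E M) (V : SmoothVectorField F T)
    (f : FormalSection F T E M) : FormalSection F T E M where
  toFun σ := PowerSeries.mk (fun n => derivAlong V (fun τ => PowerSeries.coeff n (f τ)) (f.smooth n) σ)
    + formalApply (D.A σ (V σ)) (f σ)
  smooth n := by
    simp only [map_add, PowerSeries.coeff_mk, formalApply]
    exact isSmoothFamily_add (contMDiff_derivAlong V (f.smooth n))
      (isSmoothFamily_sum _ fun p _ => D.smooth p.1 V _ (f.smooth p.2))

/-- Flatness: `D_V D_W - D_W D_V - D_{[V, W]} = 0`. -/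
def FormalConnection.IsFlat [FiniteDimensional ℝ F] (D : FormalConnection F T E M) : Prop :=
  ∀ (V W : SmoothVectorField F T) (f : FormalSection F T E M) (σ : T),
    D.covDeriv V (D.covDeriv W f) σ - D.covDeriv W (D.covDeriv V f) σ
      - D.covDeriv (V.bracket W) f σ = 0

end Families

/-! ### Symplectic manifolds, star products -/

section Symplectic

variable (E : Type*) [NormedAddCommGroup E] [NormedSpace ℝ E]
  (M : Type*) [TopologicalSpace M] [ChartedSpace E M] [IsManifold 𝓘(ℝ, E) ∞ M]

/-- Symplectic forms on `M`: smooth, closed, nondegenerate `2`-forms. -/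
structure SymplecticForm where
  toFun : ∀ x : M, TangentSpace 𝓘(ℝ, E) x →ₗ[ℝ] TangentSpace 𝓘(ℝ, E) x →ₗ[ℝ] ℝ
  alt : ∀ x v, toFun x v v = 0
  nondegenerate : ∀ x v, (∀ w, toFun x v w = 0) → v = 0
  smooth : ∀ X Y : SmoothVectorField E M,
    ContMDiff 𝓘(ℝ, E) 𝓘(ℝ, ℝ) ∞ (fun x => toFun x (X x) (Y x))
  closed : ∀ (X Y Z : SmoothVectorField E M) (x : M),
    mvfderiv 𝓘(ℝ, E) (fun y => toFun y (Y y) (Z y)) x (X x)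
      - mvfderiv 𝓘(ℝ, E) (fun y => toFun y (X y) (Z y)) x (Y x)
      + mvfderiv 𝓘(ℝ, E) (fun y => toFun y (X y) (Y y)) x (Z x)
      - toFun x (VectorField.mlieBracket 𝓘(ℝ, E) X Y x) (Z x)
      + toFun x (VectorField.mlieBracket 𝓘(ℝ, E) X Z x) (Y x)
      - toFun x (VectorField.mlieBracket 𝓘(ℝ, E) Y Z x) (X x) = 0

variable {E M}

instance : CoeFun (SymplecticForm E M)
    (fun _ => ∀ x : M, TangentSpace 𝓘(ℝ, E) x →ₗ[ℝ] TangentSpace 𝓘(ℝ, E) x →ₗ[ℝ] ℝ) :=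
  ⟨SymplecticForm.toFun⟩

/-- The Hamiltonian vector `X_u(x)` of a real function `u`: the vector with `Ω(X_u, ·) = du`. -/
def SymplecticForm.hamiltonian (Ω : SymplecticForm E M) (u : M → ℝ) (x : M) :
    TangentSpace 𝓘(ℝ, E) x :=
  Function.invFun (fun v => Ω x v) (mvfderiv 𝓘(ℝ, E) u x).toLinearMap

/-- The Poisson bracket `{f, g} = dg(X_f)`, extended complex-bilinearly to complex functions.
It is the bracket of the bivector `Ω⁻¹` normalised by `Ω · Ω⁻¹ = id`; for `Ω = dx ∧ dy` one has
`{x, y} = -1`. -/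
def SymplecticForm.poisson (Ω : SymplecticForm E M) (f g : M → ℂ) (x : M) : ℂ :=
  mvfderiv 𝓘(ℝ, E) g x (Ω.hamiltonian (fun y => (f y).re) x)
    + Complex.I * mvfderiv 𝓘(ℝ, E) g x (Ω.hamiltonian (fun y => (f y).im) x)

/-- Star products on `(M, Ω)`, given by their coefficients `c^k`. -/
structure StarProduct (Ω : SymplecticForm E M) where
  coeff : ℕ → SmoothFun E M →ₗ[ℂ] SmoothFun E M →ₗ[ℂ] SmoothFun E M
  assoc : ∀ f g k : FormalFun E M,
    formalMul coeff (formalMul coeff f g) k = formalMul coeff f (formalMul coeff g k)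
  mul_one : ∀ f : FormalFun E M, formalMul coeff f 1 = f
  one_mul : ∀ f : FormalFun E M, formalMul coeff 1 f = f
  coeff_zero : ∀ f g : SmoothFun E M, coeff 0 f g = f * g
  coeff_one : ∀ (f g : SmoothFun E M) (x : M),
    (coeff 1 f g : M → ℂ) x - (coeff 1 g f : M → ℂ) x = Complex.I * Ω.poisson f g x

/-- The product `f ⋆ g` of formal functions. -/
def StarProduct.mul {Ω : SymplecticForm E M} (S : StarProduct Ω) (f g : FormalFun E M) :
    FormalFun E M := formalMul S.coeff f g

/-- `J` is an integrable almost complex structure compatible with `Ω`, so that `(M, Ω, J)` is a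
Kähler manifold with metric `Ω(·, J ·)`. -/
structure IsKahler (Ω : SymplecticForm E M)
    (J : ∀ x : M, TangentSpace 𝓘(ℝ, E) x →ₗ[ℝ] TangentSpace 𝓘(ℝ, E) x) : Prop where
  sq : ∀ x v, J x (J x v) = -v
  compatible : ∀ x v w, Ω x (J x v) (J x w) = Ω x v w
  pos : ∀ x v, v ≠ 0 → 0 < Ω x v (J x v)
  integrable : ∀ (X Y : SmoothVectorField E M) (x : M),
    VectorField.mlieBracket 𝓘(ℝ, E) (fun y => J y (X y)) (fun y => J y (Y y)) x
      - J x (VectorField.mlieBracket 𝓘(ℝ, E) (fun y => J y (X y)) Y x)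
      - J x (VectorField.mlieBracket 𝓘(ℝ, E) X (fun y => J y (Y y)) x)
      - VectorField.mlieBracket 𝓘(ℝ, E) X Y x = 0

/-- Smooth families of compatible Kähler structures on `(M, Ω)` parametrised by `T`. -/
structure KahlerFamily (Ω : SymplecticForm E M)
    (F : Type*) [NormedAddCommGroup F] [NormedSpace ℝ F]
    (T : Type*) [TopologicalSpace T] [ChartedSpace F T] where
  J : T → ∀ x : M, TangentSpace 𝓘(ℝ, E) x →ₗ[ℝ] TangentSpace 𝓘(ℝ, E) x
  smooth : ∀ X : SmoothVectorField E M,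
    ContMDiff (𝓘(ℝ, F).prod 𝓘(ℝ, E)) 𝓘(ℝ, E).tangent ∞
      (fun p : T × M => (⟨p.2, J p.1 p.2 (X p.2)⟩ : TangentBundle 𝓘(ℝ, E) M))
  isKahler : ∀ σ, IsKahler Ω (J σ)

/-- A prequantum line bundle of `(M, Ω)`: a Hermitian line bundle `L` with a compatible connection of
curvature `-iΩ`, described in local unitary frames over an open cover `U i`.  The `g i j` are the
`U(1)`-valued transition functions; a section is a family of local functions `s i` with
`s i = g i j * s j`, and `∇ s` is given by `d(s i) - i θ_i (s i)` with real forms `θ_i`. -/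
structure PrequantumBundle (Ω : SymplecticForm E M) (ι : Type*) where
  U : ι → Set M
  isOpen : ∀ i, IsOpen (U i)
  indexAt : M → ι
  mem_indexAt : ∀ x, x ∈ U (indexAt x)
  g : ι → ι → M → ℂ
  g_smooth : ∀ i j, ContMDiffOn 𝓘(ℝ, E) 𝓘(ℝ, ℂ) ∞ (g i j) (U i ∩ U j)
  g_norm : ∀ i j, ∀ x ∈ U i ∩ U j, ‖g i j x‖ = 1
  g_cocycle : ∀ i j k, ∀ x ∈ U i ∩ U j ∩ U k, g i j x * g j k x = g i k x
  θ : ι → CovectorFamily E M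
  θ_smooth : ∀ (i : ι) (X : SmoothVectorField E M),
    ContMDiffOn 𝓘(ℝ, E) 𝓘(ℝ, ℝ) ∞ (fun x => θ i x (X x)) (U i)
  θ_transition : ∀ i j, ∀ x ∈ U i ∩ U j, ∀ v : TangentSpace 𝓘(ℝ, E) x,
    mvfderiv 𝓘(ℝ, E) (g i j) x v = Complex.I * ((θ i x v - θ j x v : ℝ) : ℂ) * g i j x
  curvature : ∀ (i : ι) (X Y : SmoothVectorField E M), ∀ x ∈ U i,
    mvfderiv 𝓘(ℝ, E) (fun y => θ i y (Y y)) x (X x)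
      - mvfderiv 𝓘(ℝ, E) (fun y => θ i y (X y)) x (Y x)
      - θ i x (VectorField.mlieBracket 𝓘(ℝ, E) X Y x) = Ω x (X x) (Y x)

namespace PrequantumBundle

variable {Ω : SymplecticForm E M} {ι : Type*} (L : PrequantumBundle Ω ι)

/-- `s` is a smooth section of `L^k` (by convention `s i` is extended by zero outside `U i`). -/
structure IsSection (k : ℕ) (s : ι → M → ℂ) : Prop where
  smooth : ∀ i, ContMDiffOn 𝓘(ℝ, E) 𝓘(ℝ, ℂ) ∞ (s i) (L.U i)
  transition : ∀ i j, ∀ x ∈ L.U i ∩ L.U j, s i x = L.g i j x ^ k * s j x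
  eq_zero : ∀ i, ∀ x ∉ L.U i, s i x = 0

/-- The covariant derivative `∇_v s` on `L^k` in the frame `i`. -/
def nabla (k : ℕ) (s : ι → M → ℂ) (i : ι) (x : M) (v : TangentSpace 𝓘(ℝ, E) x) : ℂ :=
  mvfderiv 𝓘(ℝ, E) (s i) x v - Complex.I * k * (L.θ i x v : ℝ) * s i x

/-- `s ∈ H⁰(M_J, L^k)`: `s` is a smooth section of `L^k` with `∇_{X''} s = 0` for all vectors `X`,
where `X'' = (X + i J X) / 2`. -/
def IsHolomorphic (J : ∀ x : M, TangentSpace 𝓘(ℝ, E) x →ₗ[ℝ] TangentSpace 𝓘(ℝ, E) x) (k : ℕ)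
    (s : ι → M → ℂ) : Prop :=
  L.IsSection k s ∧ ∀ i, ∀ x ∈ L.U i, ∀ v : TangentSpace 𝓘(ℝ, E) x,
    L.nabla k s i x v + Complex.I * L.nabla k s i x (J x v) = 0

end PrequantumBundle

end Symplectic

/-! ### Berezin-Toeplitz quantization of compact Kähler manifolds -/

section Toeplitz

variable {d : ℕ} {M : Type*} [TopologicalSpace M] [ChartedSpace (EuclideanSpace ℝ (Fin d)) M]
  [IsManifold (𝓡 d) ∞ M] [MeasurableSpace M] [BorelSpace M]

/-- The matrix of `Ω` in the chart `e` at the point with coordinates `y`. -/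
def SymplecticForm.chartMatrix (Ω : SymplecticForm (EuclideanSpace ℝ (Fin d)) M)
    (e : OpenPartialHomeomorph M (EuclideanSpace ℝ (Fin d))) (y : EuclideanSpace ℝ (Fin d)) :
    Matrix (Fin d) (Fin d) ℝ :=
  Matrix.of fun i j => Ω (e.symm y)
    (mfderiv (𝓡 d) (𝓡 d) e.symm y (EuclideanSpace.single i (1 : ℝ)))
    (mfderiv (𝓡 d) (𝓡 d) e.symm y (EuclideanSpace.single j (1 : ℝ)))

/-- The Liouville measure, i.e. the measure of the volume form `Ω^n / n!`.  On a chart domain it has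
density `√det(Ω_ij)` with respect to Lebesgue measure; the measure on `M` is the supremum of these
(mutually compatible) measures over chart domains. -/
def SymplecticForm.liouville (Ω : SymplecticForm (EuclideanSpace ℝ (Fin d)) M) : Measure M :=
  ⨆ x : M, (((volume.restrict (chartAt (EuclideanSpace ℝ (Fin d)) x).target).withDensity
    (fun y => ENNReal.ofReal
      (Real.sqrt (Ω.chartMatrix (chartAt (EuclideanSpace ℝ (Fin d)) x) y).det))).map
    (chartAt (EuclideanSpace ℝ (Fin d)) x).symm)

namespace PrequantumBundle

variable {Ω : SymplecticForm (EuclideanSpace ℝ (Fin d)) M} {ι : Type*} (L : PrequantumBundle Ω ι)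

/-- The `L²` inner product of two sections of `L^k`; the integrand is the pointwise Hermitian
product and does not depend on the choice of frame. -/
def innerL2 (s t : ι → M → ℂ) : ℂ :=
  ∫ x, (starRingEnd ℂ) (s (L.indexAt x) x) * t (L.indexAt x) x ∂Ω.liouville

/-- The `L²` norm of a section of `L^k`. -/
def normL2 (s : ι → M → ℂ) : ℝ := Real.sqrt (L.innerL2 s s).re

variable (J : ∀ x : M, TangentSpace (𝓡 d) x →ₗ[ℝ] TangentSpace (𝓡 d) x)

open Classical in
/-- The orthogonal projection `π^{(k)}` of a section of `L^k` to the space `H⁰(M_J, L^k)`, which is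
finite-dimensional when `M` is compact, so that the projection exists and is unique. -/
def holProj (k : ℕ) (s : ι → M → ℂ) : ι → M → ℂ :=
  if h : ∃ t, L.IsHolomorphic J k t ∧
      ∀ u, L.IsHolomorphic J k u → L.innerL2 u t = L.innerL2 u s
  then h.choose else 0

/-- The Toeplitz operator `T_f^{(k)} s = π^{(k)}(f s)`. -/
def toeplitz (k : ℕ) (f : SmoothFun (EuclideanSpace ℝ (Fin d)) M) (s : ι → M → ℂ) : ι → M → ℂ :=
  L.holProj J k (fun i x => (f : M → ℂ) x * s i x)

/-- `S` is the Berezin-Toeplitz star product of the Kähler manifold `(M, Ω, J)`: for every positive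
integer `N`, in operator norm on `H⁰(M_J, L^k)`,
`‖T_f T_g - ∑_{l ≤ N} k^{-l} T_{c^l(f, g)}‖ = O(k^{-(N + 1)})` as `k → ∞`. -/
def IsBerezinToeplitz (S : StarProduct Ω) : Prop :=
  ∀ (f g : SmoothFun (EuclideanSpace ℝ (Fin d)) M) (N : ℕ), 1 ≤ N →
    ∃ C : ℝ, ∀ᶠ k : ℕ in atTop, ∀ s, L.IsHolomorphic J k s →
      L.normL2 (L.toeplitz J k f (L.toeplitz J k g s)
        - ∑ l ∈ Finset.range (N + 1), ((k : ℂ) ^ l)⁻¹ • L.toeplitz J k (S.coeff l f g) s)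
      ≤ C * ((k : ℝ) ^ (N + 1))⁻¹ * L.normL2 s

end PrequantumBundle

end Toeplitz

/-! ### Formal Hitchin connections and gauge equivalence -/

section Hitchin

variable {F : Type*} [NormedAddCommGroup F] [NormedSpace ℝ F]
  {T : Type*} [TopologicalSpace T] [ChartedSpace F T] [IsManifold 𝓘(ℝ, F) ∞ T]
  {E : Type*} [NormedAddCommGroup E] [NormedSpace ℝ E]
  {M : Type*} [TopologicalSpace M] [ChartedSpace E M] [IsManifold 𝓘(ℝ, E) ∞ M]
  {Ω : SymplecticForm E M}

/-- `D` is compatible with the family of star products: for smooth sections `f, g` also `f ⋆ g` is a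
smooth section, and `D_V (f ⋆ g) = D_V f ⋆ g + f ⋆ D_V g`. -/
def FormalConnection.IsCompatible (D : FormalConnection F T E M) (star : T → StarProduct Ω) : Prop :=
  ∀ f g : FormalSection F T E M, ∃ fg : FormalSection F T E M,
    (∀ σ, fg σ = (star σ).mul (f σ) (g σ)) ∧
    ∀ (V : SmoothVectorField F T) (σ : T), D.covDeriv V fg σ =
      (star σ).mul (D.covDeriv V f σ) (g σ) + (star σ).mul (f σ) (D.covDeriv V g σ)

variable (F) in
/-- Self-equivalences of a family of star products: smooth maps `P = ∑ P_k h^k` from `T` to formal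
differential operators on `M` with `P = id` modulo `h` and `P_σ(f ⋆_σ g) = P_σ(f) ⋆_σ P_σ(g)`. -/
structure SelfEquivalence (star : T → StarProduct Ω) where
  P : T → ℕ → Module.End ℂ (SmoothFun E M)
  P_zero : ∀ σ, P σ 0 = 1
  isDiffOp : ∀ (k : ℕ) (σ₀ : T), ∃ N : ℕ, ∀ᶠ σ in 𝓝 σ₀, IsDiffOp N (P σ k)
  smooth : ∀ (k : ℕ) (f : T → SmoothFun E M),
    IsSmoothFamily F f → IsSmoothFamily F (fun σ => P σ k (f σ))
  map_mul : ∀ (σ : T) (f g : FormalFun E M), formalApply (P σ) ((star σ).mul f g) =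
    (star σ).mul (formalApply (P σ) f) (formalApply (P σ) g)

/-- The action of a self-equivalence on smooth sections. -/
def SelfEquivalence.apply {star : T → StarProduct Ω} (P : SelfEquivalence F star)
    (f : FormalSection F T E M) : FormalSection F T E M where
  toFun σ := formalApply (P.P σ) (f σ)
  smooth n := by
    simp only [PowerSeries.coeff_mk, formalApply]
    exact isSmoothFamily_sum _ fun p _ => P.smooth p.1 _ (f.smooth p.2)

/-- `D` and `D'` are gauge equivalent: `D'_V = P⁻¹ D_V P` for all `V`, for a self-equivalence `P` of
the family of star products (which is invertible on smooth sections). -/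
def GaugeEquivalent (star : T → StarProduct Ω) (D D' : FormalConnection F T E M) : Prop :=
  ∃ (P : SelfEquivalence F star) (Pinv : FormalSection F T E M → FormalSection F T E M),
    Function.LeftInverse Pinv P.apply ∧ Function.RightInverse Pinv P.apply ∧
    ∀ (V : SmoothVectorField F T) (f : FormalSection F T E M),
      D'.covDeriv V f = Pinv (D.covDeriv V (P.apply f))

/-- A flat formal connection that is compatible with the given family of star products. For the
family of Berezin-Toeplitz star products these are the formal Hitchin connections. -/
structure FormalConnection.IsFlatCompatible [FiniteDimensional ℝ F] (D : FormalConnection F T E M)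
    (star : T → StarProduct Ω) : Prop where
  isCompatible : D.IsCompatible star
  isFlat : D.IsFlat

end Hitchin

end

end FormalHitchin

/-!
A formal connection is the trivial connection modulo `h`, so a trivialisation `G` of a flat one can
be found order by order in `h`: the coefficients of the transport equation `dG = -A G` read
`dG_n = α_n` with `α_n` determined by the lower coefficients. Flatness makes `α_n` closed, and
`H¹(T, ℝ) = 0` yields a primitive, normalised by `G = 1` at a base point of each component of `T`.

Compatibility with the star products makes products of parallel sections parallel. As the parallel
sections are the `σ ↦ G_σ f`, the operator `G_σ` carries the star product at the base point to the
star product at `σ`. For two formal Hitchin connections with trivialisations `G` and `G'` the gauge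
transformation is therefore `P = G G'⁻¹`.

The analytic point is that operators of locally bounded order that depend smoothly on `σ` when
applied to a fixed function also act smoothly on smooth families of functions. This goes by
induction on the order: by Hadamard's lemma a function vanishing at a point is near it a combination
of products with functions vanishing there, and a product is handled by a commutator.
-/

namespace FormalHitchin

noncomputable section

attribute [local instance] LieRing.ofAssociativeRing

/-! ### Differential operators of a commutative algebra and formal operators -/

section DiffOp

variable {R A : Type*} [CommRing R] [CommRing A] [Algebra R A]

variable (R A) in
/-- The differential operators of order less than `n` on a commutative algebra `A` (order in the
sense of Grothendieck). Counting from `n = 0`, where only the zero operator is left, gives the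
inductions on the order a trivial start. -/
def diffOpLT : ℕ → Submodule R (Module.End R A)
  | 0 => ⊥
  | n + 1 => ⨅ g : A, (diffOpLT n).comap (LieAlgebra.ad R (Module.End R A) (LinearMap.mulLeft R g))

theorem mem_diffOpLT_zero {P : Module.End R A} : P ∈ diffOpLT R A 0 ↔ P = 0 :=
  Iff.rfl

theorem mem_diffOpLT_succ {n : ℕ} {P : Module.End R A} :
    P ∈ diffOpLT R A (n + 1) ↔ ∀ g, ⁅P, LinearMap.mulLeft R g⁆ ∈ diffOpLT R A n := by
  simp only [diffOpLT, Submodule.mem_iInf, Submodule.mem_comap, LieAlgebra.ad_apply]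
  refine forall_congr' fun g => ?_
  rw [← neg_mem_iff, lie_skew]

variable (R A) in
theorem diffOpLT_mono : Monotone (diffOpLT R A) := by
  refine monotone_nat_of_le_succ fun n => ?_
  induction n with
  | zero => exact bot_le
  | succ n ih => exact fun P hP =>
      mem_diffOpLT_succ.2 fun g => ih (mem_diffOpLT_succ.1 hP g)

theorem mul_mem_diffOpLT {m n : ℕ} {P Q : Module.End R A} (hP : P ∈ diffOpLT R A m)
    (hQ : Q ∈ diffOpLT R A n) : P * Q ∈ diffOpLT R A (m + n) := by
  induction m generalizing n P Q with
  | zero => simp [mem_diffOpLT_zero.1 hP]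
  | succ m ihm =>
    induction n generalizing Q with
    | zero => simp [mem_diffOpLT_zero.1 hQ]
    | succ n ihn =>
      refine mem_diffOpLT_succ.2 fun g => ?_
      have leibniz : ⁅P * Q, LinearMap.mulLeft R g⁆ =
          P * ⁅Q, LinearMap.mulLeft R g⁆ + ⁅P, LinearMap.mulLeft R g⁆ * Q := by
        simp only [Ring.lie_def]
        rw [mul_sub, sub_mul]; simp only [mul_assoc]; abel
      rw [leibniz]
      refine add_mem (ihn (mem_diffOpLT_succ.1 hQ g)) ?_
      exact diffOpLT_mono R A (by lia) (ihm (mem_diffOpLT_succ.1 hP g) hQ)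

theorem one_mem_diffOpLT_one : (1 : Module.End R A) ∈ diffOpLT R A 1 :=
  mem_diffOpLT_succ.2 fun g => mem_diffOpLT_zero.2 (by simp [Ring.lie_def])

end DiffOp

section FormalOp

variable {R A : Type*} [CommRing R] [CommRing A] [Algebra R A]

/-- The action of formal operators `∑ P_k h^k` on formal elements `∑ f_k h^k` of an algebra, with
operators encoded as power series so that composition is the product of power series. -/
def formalAction (P : PowerSeries (Module.End R A)) : PowerSeries A →+ PowerSeries A where
  toFun f := PowerSeries.mk fun n => ∑ p ∈ Finset.HasAntidiagonal.antidiagonal n,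
    PowerSeries.coeff p.1 P (PowerSeries.coeff p.2 f)
  map_zero' := by ext; simp
  map_add' f g := by ext; simp [Finset.sum_add_distrib]

theorem coeff_formalAction (P : PowerSeries (Module.End R A)) (f : PowerSeries A) (n : ℕ) :
    PowerSeries.coeff n (formalAction P f) = ∑ p ∈ Finset.HasAntidiagonal.antidiagonal n,
      PowerSeries.coeff p.1 P (PowerSeries.coeff p.2 f) := by
  simp [formalAction]

/- An element `f` is the value at `1` of multiplication by `f`, so the action of `P` on `f` is read
off the product of `P` with an operator-valued series; associativity of the action is then that of
power series. -/
theorem coeff_formalAction_eq_coeff_mul_apply_one (P : PowerSeries (Module.End R A))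
    (f : PowerSeries A) (n : ℕ) :
    PowerSeries.coeff n (formalAction P f) =
      PowerSeries.coeff n (P * PowerSeries.map (Algebra.lmul R A).toRingHom f) 1 := by
  simp [coeff_formalAction, PowerSeries.coeff_mul]

theorem coeff_formalAction_C (P : PowerSeries (Module.End R A)) (f : A) (n : ℕ) :
    PowerSeries.coeff n (formalAction P (PowerSeries.C f)) = PowerSeries.coeff n P f := by
  rw [coeff_formalAction, Finset.sum_eq_single (n, 0)]
  · simp
  · rintro ⟨i, j⟩ hij hne
    have hj : j ≠ 0 := by
      rintro rfl
      simp_all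
    simp [PowerSeries.coeff_C, hj]
  · simp

theorem formalAction_one (f : PowerSeries A) :
    formalAction (1 : PowerSeries (Module.End R A)) f = f := by
  ext n
  simp [coeff_formalAction_eq_coeff_mul_apply_one]

theorem formalAction_neg (P : PowerSeries (Module.End R A)) (f : PowerSeries A) :
    formalAction (-P) f = -formalAction P f := by
  ext n
  simp [coeff_formalAction]

theorem formalAction_mul (P Q : PowerSeries (Module.End R A)) (f : PowerSeries A) :
    formalAction (P * Q) f = formalAction P (formalAction Q f) := by
  ext n
  rw [coeff_formalAction_eq_coeff_mul_apply_one, mul_assoc, PowerSeries.coeff_mul,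
    coeff_formalAction, LinearMap.sum_apply]
  exact Finset.sum_congr rfl fun p _ =>
    congrArg _ (coeff_formalAction_eq_coeff_mul_apply_one Q f p.2).symm

variable {P : PowerSeries (Module.End R A)}

theorem formalAction_invOfUnit_formalAction (hP : PowerSeries.coeff 0 P = 1) (f : PowerSeries A) :
    formalAction (P.invOfUnit 1) (formalAction P f) = f := by
  rw [← formalAction_mul, P.invOfUnit_mul 1 (by simpa using hP), formalAction_one]

theorem formalAction_formalAction_invOfUnit (hP : PowerSeries.coeff 0 P = 1) (f : PowerSeries A) :
    formalAction P (formalAction (P.invOfUnit 1) f) = f := by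
  rw [← formalAction_mul, P.mul_invOfUnit 1 (by simpa using hP), formalAction_one]

end FormalOp

section SmoothFun

variable {E : Type*} [NormedAddCommGroup E] [NormedSpace ℝ E]
  {M : Type*} [TopologicalSpace M] [ChartedSpace E M]

theorem isDiffOp_iff_mem_diffOpLT {n : ℕ} {P : Module.End ℂ (SmoothFun E M)} :
    IsDiffOp n P ↔ P ∈ diffOpLT ℂ (SmoothFun E M) (n + 1) := by
  rw [mem_diffOpLT_succ]
  induction n generalizing P with
  | zero => exact Iff.rfl
  | succ n ih => exact forall_congr' fun g => ih.trans mem_diffOpLT_succ.symm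

theorem formalApply_coeff (P : PowerSeries (Module.End ℂ (SmoothFun E M))) (f : FormalFun E M) :
    formalApply (fun n => PowerSeries.coeff n P) f = formalAction P f := by
  ext1 n
  simp [formalApply, coeff_formalAction]

end SmoothFun

/-! ### Parametric integrals and Hadamard's lemma -/

section ParametricIntegral

variable {S : Type*} [NormedAddCommGroup S] [NormedSpace ℝ S] [FiniteDimensional ℝ S]
  {Y : Type*} [NormedAddCommGroup Y] [NormedSpace ℝ Y]

theorem hasFDerivAt_parametric_integral {f : S → ℝ → Y} (hf : ContDiff ℝ 1 (Function.uncurry f))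
    (s₀ : S) :
    HasFDerivAt (fun s => ∫ t in (0 : ℝ)..1, f s t)
      (∫ t in (0 : ℝ)..1, fderiv ℝ (fun s => f s t) s₀) s₀ := by
  have hslice : ∀ s, Continuous (f s) := fun s => hf.continuous.comp (Continuous.prodMk_right s)
  have hd : Continuous (fun p : S × ℝ => fderiv ℝ (fun s => f s p.2) p.1) := by
    have : ContDiff ℝ 0 (fun p : S × ℝ => fderiv ℝ (fun s => f s p.2) p.1) := by
      refine ContDiff.fderiv (m := 1) (n := 0) (f := fun (p : S × ℝ) s => f s p.2) ?_
        contDiff_fst (zero_add 1).le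
      exact hf.comp (contDiff_snd.prodMk (contDiff_snd.comp contDiff_fst))
    exact this.continuous
  have : ProperSpace S := FiniteDimensional.proper ℝ S
  obtain ⟨C, hC⟩ := ((isCompact_closedBall s₀ (1 : ℝ)).prod
    (isCompact_Icc (a := (0 : ℝ)) (b := 1))).exists_bound_of_continuousOn hd.continuousOn
  refine intervalIntegral.hasFDerivAt_integral_of_dominated_of_fderiv_le
    (F' := fun s t => fderiv ℝ (fun s => f s t) s) (bound := fun _ => C)
    (Metric.closedBall_mem_nhds s₀ one_pos) (Eventually.of_forall fun s =>
      (hslice s).aestronglyMeasurable) ((hslice s₀).intervalIntegrable _ _)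
    ((hd.comp (by fun_prop : Continuous fun t : ℝ => (s₀, t))).aestronglyMeasurable) ?_ (by simp) ?_
  · refine Eventually.of_forall fun t ht s hs => ?_
    rw [Set.uIoc_of_le zero_le_one] at ht
    exact hC (s, t) ⟨hs, ⟨ht.1.le, ht.2⟩⟩
  · refine Eventually.of_forall fun t _ s _ => ?_
    have : ContDiff ℝ 1 (fun s => f s t) := hf.comp (contDiff_id.prodMk contDiff_const)
    exact (this.differentiable (by simp) s).hasFDerivAt

theorem contDiff_parametric_integral_nat (n : ℕ) {f : S → ℝ → Y}
    (hf : ContDiff ℝ ∞ (Function.uncurry f)) :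
    ContDiff ℝ n (fun s => ∫ t in (0 : ℝ)..1, f s t) := by
  induction n generalizing f with
  | zero =>
    simp only [CharP.cast_eq_zero, contDiff_zero]
    exact intervalIntegral.continuous_parametric_intervalIntegral_of_continuous' hf.continuous _ _
  | succ n ih =>
    push_cast
    have h1 : ContDiff ℝ 1 (Function.uncurry f) := hf.of_le (by exact_mod_cast le_top)
    have hD : ContDiff ℝ ∞ (fun p : S × ℝ => fderiv ℝ (fun s => f s p.2) p.1) := by
      refine ContDiff.fderiv (m := ∞) (n := ∞) (f := fun (p : S × ℝ) s => f s p.2) ?_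
        contDiff_fst (by simp)
      exact hf.comp (contDiff_snd.prodMk (contDiff_snd.comp contDiff_fst))
    rw [contDiff_succ_iff_fderiv_apply]
    refine ⟨fun s => (hasFDerivAt_parametric_integral h1 s).differentiableAt, by simp, fun y => ?_⟩
    have e : (fun s => fderiv ℝ (fun s => ∫ t in (0 : ℝ)..1, f s t) s y) =
        fun s => ∫ t in (0 : ℝ)..1, fderiv ℝ (fun s => f s t) s y := by
      ext s
      rw [(hasFDerivAt_parametric_integral h1 s).fderiv,
        ContinuousLinearMap.intervalIntegral_apply]
      exact Continuous.intervalIntegrable (hD.continuous.comp (Continuous.prodMk_right s)) ..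
    rw [e]
    exact ih (f := fun s t => fderiv ℝ (fun s => f s t) s y) (hD.clm_apply contDiff_const)

theorem contDiff_parametric_integral {f : S → ℝ → Y} (hf : ContDiff ℝ ∞ (Function.uncurry f)) :
    ContDiff ℝ ∞ (fun s => ∫ t in (0 : ℝ)..1, f s t) :=
  contDiff_infty.2 fun n => contDiff_parametric_integral_nat n hf

theorem sub_eq_integral_fderiv [CompleteSpace Y] {E : Type*} [NormedAddCommGroup E]
    [NormedSpace ℝ E] {f : E → Y} (hf : Differentiable ℝ f) (u v : E)
    (hf' : Continuous fun t : ℝ => fderiv ℝ f (v + t • (u - v)) (u - v)) :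
    f u - f v = ∫ t in (0 : ℝ)..1, fderiv ℝ f (v + t • (u - v)) (u - v) := by
  have hder : ∀ t ∈ Set.uIcc (0 : ℝ) 1, HasDerivAt (fun t : ℝ => f (v + t • (u - v)))
      (fderiv ℝ f (v + t • (u - v)) (u - v)) t := fun t _ => by
    have hray : HasDerivAt (fun t : ℝ => v + t • (u - v)) (u - v) t := by
      simpa using ((hasDerivAt_id t).smul_const (u - v)).const_add v
    exact (hf _).hasFDerivAt.comp_hasDerivAt t hray
  rw [intervalIntegral.integral_eq_sub_of_hasDerivAt hder (hf'.intervalIntegrable _ _)]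
  simp

theorem exists_hadamard [CompleteSpace Y] {E : Type*} [NormedAddCommGroup E] [NormedSpace ℝ E]
    [FiniteDimensional ℝ E] {f : S × E → Y} (hf : ContDiff ℝ ∞ f) :
    ∃ H : S × E × E → E →L[ℝ] Y, ContDiff ℝ ∞ H ∧
      (∀ s u v, f (s, u) - f (s, v) = H (s, u, v) (u - v)) ∧
      ∀ s v, H (s, v, v) = fderiv ℝ (fun e => f (s, e)) v := by
  set G : (S × E × E) × ℝ → E →L[ℝ] Y :=
    fun p => fderiv ℝ (fun e => f (p.1.1, e)) (p.1.2.2 + p.2 • (p.1.2.1 - p.1.2.2)) with hG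
  have hG_smooth : ContDiff ℝ ∞ G := by
    refine ContDiff.fderiv (m := ∞) (n := ∞) (f := fun (p : (S × E × E) × ℝ) e => f (p.1.1, e)) ?_
      (by fun_prop) (by simp)
    exact hf.comp (by fun_prop)
  refine ⟨fun p => ∫ t in (0 : ℝ)..1, G (p, t),
    contDiff_parametric_integral (f := fun p t => G (p, t)) hG_smooth, fun s u v => ?_,
    fun s v => by simp [hG]⟩
  have hG_cont : Continuous fun t : ℝ => G ((s, u, v), t) := hG_smooth.continuous.comp (by fun_prop)
  have hfs : ContDiff ℝ ∞ (fun e => f (s, e)) := hf.comp (by fun_prop)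
  rw [ContinuousLinearMap.intervalIntegral_apply (hG_cont.intervalIntegrable _ _)]
  exact sub_eq_integral_fderiv (hfs.differentiable (by simp)) u v
    (hG_cont.clm_apply continuous_const)

end ParametricIntegral

/-! ### Globally defined local coordinates -/

section Cutoff

variable {E : Type*} [NormedAddCommGroup E] [NormedSpace ℝ E] [FiniteDimensional ℝ E]

theorem exists_contDiff_eventuallyEq_id {c : E} {U : Set E} (hU : U ∈ 𝓝 c) :
    ∃ θ : E → E, ContDiff ℝ ∞ θ ∧ θ =ᶠ[𝓝 c] id ∧ ∀ e, θ e ∈ U := by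
  obtain ⟨r, hr, hrU⟩ := Metric.mem_nhds_iff.1 hU
  let b : ContDiffBump c := ⟨r / 4, r / 2, by positivity, by linarith⟩
  refine ⟨fun e => c + b e • (e - c),
    contDiff_const.add (b.contDiff.smul (contDiff_id.sub contDiff_const)), ?_, fun e => hrU ?_⟩
  · filter_upwards [b.eventuallyEq_one] with e he
    simp [he]
  · simp only [Metric.mem_ball, dist_self_add_left, norm_smul, Real.norm_eq_abs,
      abs_of_nonneg b.nonneg]
    rcases lt_or_ge (dist e c) (r / 2) with he | he
    · rw [dist_eq_norm] at he
      calc b e * ‖e - c‖ ≤ 1 * ‖e - c‖ := by gcongr; exact b.le_one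
        _ < r := by linarith
    · simpa [b.zero_of_le_dist he] using hr

end Cutoff

/-- Local coordinates at a point `p` of a manifold: a chart at `p`, modified away from `p` so that
it and its inverse become smooth maps that are defined everywhere. -/
structure LocalCoordinates (E : Type*) [NormedAddCommGroup E] [NormedSpace ℝ E]
    {N : Type*} [TopologicalSpace N] [ChartedSpace E N] (p : N) where
  coord : N → E
  param : E → N
  contMDiff_coord : ContMDiff 𝓘(ℝ, E) 𝓘(ℝ, E) ∞ coord
  contMDiff_param : ContMDiff 𝓘(ℝ, E) 𝓘(ℝ, E) ∞ param
  eventually_param_coord : ∀ᶠ q in 𝓝 p, param (coord q) = q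
  eventually_coord_param : ∀ᶠ e in 𝓝 (coord p), coord (param e) = e

namespace LocalCoordinates

variable {E : Type*} [NormedAddCommGroup E] [NormedSpace ℝ E]

/-- The tautological coordinates of a vector space. -/
def refl (e : E) : LocalCoordinates E e where
  coord := id
  param := id
  contMDiff_coord := contMDiff_id
  contMDiff_param := contMDiff_id
  eventually_param_coord := Eventually.of_forall fun _ => rfl
  eventually_coord_param := Eventually.of_forall fun _ => rfl

variable {N : Type*} [TopologicalSpace N] [ChartedSpace E N] {p : N}

theorem param_coord (c : LocalCoordinates E p) : c.param (c.coord p) = p :=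
  c.eventually_param_coord.self_of_nhds

theorem tendsto_param (c : LocalCoordinates E p) : Tendsto c.param (𝓝 (c.coord p)) (𝓝 p) := by
  simpa only [c.param_coord] using (c.contMDiff_param.continuous.tendsto (c.coord p))

theorem exists_param_mem [FiniteDimensional ℝ E] [T2Space N] [IsManifold 𝓘(ℝ, E) ∞ N] {U : Set N}
    (hU : U ∈ 𝓝 p) : ∃ c : LocalCoordinates E p, ∀ e, c.param e ∈ U := by
  set φ := chartAt E p
  have hp : p ∈ φ.source := mem_chart_source E p
  have hV : φ.target ∩ φ.symm ⁻¹' U ∈ 𝓝 (φ p) :=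
    inter_mem (φ.open_target.mem_nhds (φ.map_source hp))
      ((φ.continuousAt_symm (φ.map_source hp)).preimage_mem_nhds (by rwa [φ.left_inv hp]))
  obtain ⟨θ, hθ, hθ_id, hθV⟩ := exists_contDiff_eventuallyEq_id hV
  obtain ⟨b⟩ : Nonempty (SmoothBumpFunction 𝓘(ℝ, E) p) := inferInstance
  have hcoord : (fun q => b q • φ q) =ᶠ[𝓝 p] φ := by
    filter_upwards [b.eventuallyEq_one] with q hq
    simp [hq]
  have hcoord_p : b p • φ p = φ p := hcoord.self_of_nhds
  refine ⟨⟨fun q => b q • φ q, φ.symm ∘ θ, b.contMDiff_smul contMDiffOn_chart,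
    contMDiffOn_chart_symm.comp_contMDiff hθ.contMDiff fun e => (hθV e).1, ?_, ?_⟩,
    fun e => (hθV e).2⟩
  · filter_upwards [hcoord, (φ.continuousAt hp).eventually hθ_id, φ.open_source.mem_nhds hp]
      with q hq hθq hqs
    rw [hq, Function.comp_apply, hθq, id, φ.left_inv hqs]
  · have hsymm : Tendsto φ.symm (𝓝 (φ p)) (𝓝 p) := by
      simpa only [φ.left_inv hp] using (φ.continuousAt_symm (φ.map_source hp)).tendsto
    rw [hcoord_p]
    filter_upwards [hθ_id, hsymm.eventually hcoord, φ.open_target.mem_nhds (φ.map_source hp)]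
      with e hθe he het
    rw [Function.comp_apply, hθe, id, he, φ.right_inv het]

instance [FiniteDimensional ℝ E] [T2Space N] [IsManifold 𝓘(ℝ, E) ∞ N] :
    Nonempty (LocalCoordinates E p) :=
  (exists_param_mem (univ_mem (f := 𝓝 p))).nonempty

theorem contMDiffAt_prod_of_contDiffAt {F : Type*} [NormedAddCommGroup F] [NormedSpace ℝ F]
    {T : Type*} [TopologicalSpace T] [ChartedSpace F T] {σ : T} {Y : Type*} [NormedAddCommGroup Y]
    [NormedSpace ℝ Y] {h : T × N → Y} (b : LocalCoordinates F σ) (c : LocalCoordinates E p)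
    (hh : ContDiffAt ℝ ∞ (fun w : F × E => h (b.param w.1, c.param w.2)) (b.coord σ, c.coord p)) :
    ContMDiffAt (𝓘(ℝ, F).prod 𝓘(ℝ, E)) 𝓘(ℝ, Y) ∞ h (σ, p) := by
  have hcoord : ContMDiffAt (𝓘(ℝ, F).prod 𝓘(ℝ, E)) 𝓘(ℝ, F × E) ∞
      (fun q : T × N => (b.coord q.1, c.coord q.2)) (σ, p) :=
    ((b.contMDiff_coord.comp contMDiff_fst).prodMk_space
      (c.contMDiff_coord.comp contMDiff_snd)).contMDiffAt
  refine (ContMDiffAt.comp (σ, p) hh.contMDiffAt hcoord).congr_of_eventuallyEq ?_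
  filter_upwards [b.eventually_param_coord.prod_nhds c.eventually_param_coord] with q hq
  simp [hq.1, hq.2]

variable {Y : Type*} [NormedAddCommGroup Y] [NormedSpace ℝ Y]

theorem mdifferentiableAt_comp_param (c : LocalCoordinates E p) {h : N → Y}
    (hh : MDifferentiableAt 𝓘(ℝ, E) 𝓘(ℝ, Y) h p) :
    DifferentiableAt ℝ (h ∘ c.param) (c.coord p) := by
  refine MDifferentiableAt.differentiableAt (MDifferentiableAt.comp (I' := 𝓘(ℝ, E)) _ ?_
    (c.contMDiff_param.mdifferentiable (by simp) _))
  rwa [c.param_coord]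

theorem fderiv_comp_param (c : LocalCoordinates E p) {h : N → Y}
    (hh : MDifferentiableAt 𝓘(ℝ, E) 𝓘(ℝ, Y) h p) (v : TangentSpace 𝓘(ℝ, E) p) :
    fderiv ℝ (h ∘ c.param) (c.coord p) (mfderiv 𝓘(ℝ, E) 𝓘(ℝ, E) c.coord p v) =
      mvfderiv 𝓘(ℝ, E) h p v := by
  have hcomp : ((h ∘ c.param) ∘ c.coord) =ᶠ[𝓝 p] h := by
    filter_upwards [c.eventually_param_coord] with q hq
    simp [hq]
  have chain := mfderiv_comp_apply (I' := 𝓘(ℝ, E)) p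
    (c.mdifferentiableAt_comp_param hh).mdifferentiableAt
    (c.contMDiff_coord.mdifferentiable (by simp) p) v
  rw [hcomp.mfderiv_eq, mfderiv_eq_fderiv] at chain
  exact chain.symm

end LocalCoordinates

theorem exists_curve {E : Type*} [NormedAddCommGroup E] [NormedSpace ℝ E] [FiniteDimensional ℝ E]
    {N : Type*} [TopologicalSpace N] [T2Space N] [ChartedSpace E N] [IsManifold 𝓘(ℝ, E) ∞ N]
    {p : N} (v : TangentSpace 𝓘(ℝ, E) p) {U : Set N} (hU : U ∈ 𝓝 p) :
    ∃ γ : ℝ → N, ContMDiff 𝓘(ℝ, ℝ) 𝓘(ℝ, E) ∞ γ ∧ (∀ t, γ t ∈ U) ∧ γ 0 = p ∧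
      ∀ h : N → ℂ, MDifferentiableAt 𝓘(ℝ, E) 𝓘(ℝ, ℂ) h p →
        HasDerivAt (fun t => h (γ t)) (mvfderiv 𝓘(ℝ, E) h p v) 0 := by
  obtain ⟨c, hcU⟩ := LocalCoordinates.exists_param_mem (E := E) hU
  let w : E := mfderiv 𝓘(ℝ, E) 𝓘(ℝ, E) c.coord p v
  have hline : ContDiff ℝ ∞ (fun t : ℝ => c.coord p + t • w) := by fun_prop
  refine ⟨fun t => c.param (c.coord p + t • w), c.contMDiff_param.comp hline.contMDiff,
    fun t => hcU _, by simp [c.param_coord], fun h hh => ?_⟩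
  rw [← c.fderiv_comp_param hh v]
  have hderiv : HasDerivAt (fun t : ℝ => c.coord p + t • w) w 0 := by
    simpa using ((hasDerivAt_id (0 : ℝ)).smul_const w).const_add (c.coord p)
  exact (c.mdifferentiableAt_comp_param hh).hasFDerivAt.comp_hasDerivAt_of_eq (0 : ℝ) hderiv
    (by simp)

/-! ### Smooth families of functions -/

section Families

variable {F : Type*} [NormedAddCommGroup F] [NormedSpace ℝ F]
  {T : Type*} [TopologicalSpace T] [ChartedSpace F T]
  {E : Type*} [NormedAddCommGroup E] [NormedSpace ℝ E]
  {M : Type*} [TopologicalSpace M] [ChartedSpace E M]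

theorem exists_isSmoothFamily_of_contMDiff {f : T → M → ℂ}
    (hf : ContMDiff (𝓘(ℝ, F).prod 𝓘(ℝ, E)) 𝓘(ℝ, ℂ) ∞ (Function.uncurry f)) :
    ∃ g : T → SmoothFun E M, IsSmoothFamily F g ∧ ∀ σ x, (g σ : M → ℂ) x = f σ x :=
  ⟨fun σ => ⟨f σ, hf.comp (contMDiff_const.prodMk contMDiff_id)⟩, hf, fun _ _ => rfl⟩

theorem isSmoothFamily_const (g : SmoothFun E M) : IsSmoothFamily F (fun _ : T => g) :=
  ContMDiff.comp (g := (g : M → ℂ)) g.2 contMDiff_snd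

theorem isSmoothFamily_of_localCoordinates {f : T → SmoothFun E M}
    (h : ∀ (σ : T) (p : M), ∃ (b : LocalCoordinates F σ) (c : LocalCoordinates E p),
      ContDiffAt ℝ ∞ (fun w : F × E => (f (b.param w.1) : M → ℂ) (c.param w.2))
        (b.coord σ, c.coord p)) :
    IsSmoothFamily F f := by
  rintro ⟨σ, p⟩
  obtain ⟨b, c, hbc⟩ := h σ p
  exact b.contMDiffAt_prod_of_contDiffAt c hbc

namespace IsSmoothFamily

variable {f g : T → SmoothFun E M}

theorem contDiff_comp {S : Type*} [NormedAddCommGroup S] [NormedSpace ℝ S]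
    (hf : IsSmoothFamily F f) {ψ : S → T} (hψ : ContMDiff 𝓘(ℝ, S) 𝓘(ℝ, F) ∞ ψ) {χ : S → M}
    (hχ : ContMDiff 𝓘(ℝ, S) 𝓘(ℝ, E) ∞ χ) :
    ContDiff ℝ ∞ (fun s => (f (ψ s) : M → ℂ) (χ s)) :=
  contMDiff_iff_contDiff.1 (ContMDiff.comp hf (hψ.prodMk hχ))

theorem comp {F' : Type*} [NormedAddCommGroup F'] [NormedSpace ℝ F']
    {T' : Type*} [TopologicalSpace T'] [ChartedSpace F' T'] (hf : IsSmoothFamily F f)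
    {ψ : T' → T} (hψ : ContMDiff 𝓘(ℝ, F') 𝓘(ℝ, F) ∞ ψ) :
    IsSmoothFamily F' (fun s => f (ψ s)) :=
  ContMDiff.comp hf ((hψ.comp contMDiff_fst).prodMk contMDiff_snd)

theorem mul (hf : IsSmoothFamily F f) (hg : IsSmoothFamily F g) :
    IsSmoothFamily F (fun σ => f σ * g σ) :=
  (contDiff_mul (𝕜 := ℝ) (𝔸 := ℂ)).contMDiff.comp (ContMDiff.prodMk_space hf hg)

theorem smul {a : T → ℝ} (ha : ContMDiff 𝓘(ℝ, F) 𝓘(ℝ, ℝ) ∞ a) (hf : IsSmoothFamily F f) :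
    IsSmoothFamily F (fun σ => a σ • f σ) :=
  (contDiff_smul (𝕜 := ℝ) (F := ℂ)).contMDiff.comp
    (ContMDiff.prodMk_space (ha.comp contMDiff_fst) hf)

theorem neg (hf : IsSmoothFamily F f) : IsSmoothFamily F (fun σ => -f σ) :=
  ContMDiff.neg hf

theorem sub (hf : IsSmoothFamily F f) (hg : IsSmoothFamily F g) :
    IsSmoothFamily F (fun σ => f σ - g σ) :=
  ContMDiff.sub hf hg

theorem mdifferentiable (hf : IsSmoothFamily F f) (x : M) :
    MDifferentiable 𝓘(ℝ, F) 𝓘(ℝ, ℂ) (fun σ => (f σ : M → ℂ) x) :=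
  ContMDiff.mdifferentiable (n := ∞) (ContMDiff.comp hf (contMDiff_id.prodMk contMDiff_const))
    (by simp)

end IsSmoothFamily

end Families

section Hadamard

variable {E : Type*} [NormedAddCommGroup E] [NormedSpace ℝ E]
  {M : Type*} [TopologicalSpace M] [ChartedSpace E M]

theorem apply_sub_const_mul (P : Module.End ℂ (SmoothFun E M)) (u k : SmoothFun E M) (y : M) :
    (P ((u - algebraMap ℂ _ ((u : M → ℂ) y)) * k) : M → ℂ) y =
      (⁅P, LinearMap.mulLeft ℂ u⁆ k : M → ℂ) y := by
  rw [sub_mul, map_sub, ← Algebra.smul_def, map_smul]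
  rfl

variable [FiniteDimensional ℝ E] [T2Space M] [IsManifold 𝓘(ℝ, E) ∞ M]

theorem exists_smoothFun_eventuallyEq_one {p : M} {U : Set M} (hU : U ∈ 𝓝 p) :
    ∃ a : SmoothFun E M, (a : M → ℂ) =ᶠ[𝓝 p] 1 ∧ ∀ x, x ∉ U → (a : M → ℂ) x = 0 := by
  obtain ⟨χ, -, hχ⟩ := (SmoothBumpFunction.nhds_basis_support (I := 𝓘(ℝ, E)) hU).mem_iff.1 hU
  refine ⟨⟨fun x => (χ x : ℝ), Complex.ofRealCLM.contDiff.contMDiff.comp χ.contMDiff⟩, ?_,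
    fun x hx => ?_⟩
  · filter_upwards [χ.eventuallyEq_one] with x hx
    simp [hx]
  · simpa using Function.notMem_support.1 fun h => hx (hχ h)

variable {S : Type*} [NormedAddCommGroup S] [NormedSpace ℝ S] [FiniteDimensional ℝ S]

omit [T2Space M] [IsManifold 𝓘(ℝ, E) ∞ M] in
theorem exists_hadamard_coord {f : S → SmoothFun E M} (hf : IsSmoothFamily S f) {p : M}
    (c : LocalCoordinates E p) :
    ∃ u : Fin (Module.finrank ℝ E) → SmoothFun E M,
    ∃ k : Fin (Module.finrank ℝ E) → S × E → SmoothFun E M,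
      (∀ i, IsSmoothFamily (S × E) (k i)) ∧
      ∀ᶠ e in 𝓝 (c.coord p), ∀ s x, (f s : M → ℂ) (c.param (c.coord x)) =
        (f s : M → ℂ) (c.param e) +
          ∑ i, ((u i : M → ℂ) x - (u i : M → ℂ) (c.param e)) * (k i (s, e) : M → ℂ) x := by
  let b := Module.finBasis ℝ E
  have hf_coord : ContDiff ℝ ∞ (fun q : S × E => (f q.1 : M → ℂ) (c.param q.2)) :=
    hf.contDiff_comp contDiff_fst.contMDiff (c.contMDiff_param.comp contDiff_snd.contMDiff)
  obtain ⟨H, hH, hH_sub, -⟩ := exists_hadamard hf_coord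
  have hu (i) : ContMDiff 𝓘(ℝ, E) 𝓘(ℝ, ℂ) ∞ (fun x => (b.repr (c.coord x) i : ℂ)) :=
    (Complex.ofRealCLM.contDiff.comp
      (b.coord i).toContinuousLinearMap.contDiff).contMDiff.comp c.contMDiff_coord
  have hk (i) : ContMDiff (𝓘(ℝ, S × E).prod 𝓘(ℝ, E)) 𝓘(ℝ, ℂ) ∞
      (Function.uncurry fun (q : S × E) (x : M) => H (q.1, c.coord x, q.2) (b i)) := by
    have hH_apply : ContDiff ℝ ∞ fun q : (S × E) × E => H (q.1.1, q.2, q.1.2) (b i) :=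
      (hH.comp (by fun_prop)).clm_apply contDiff_const
    exact hH_apply.contMDiff.comp
      (contMDiff_fst.prodMk_space (c.contMDiff_coord.comp contMDiff_snd))
  choose k hk hk_apply using fun i => exists_isSmoothFamily_of_contMDiff (hk i)
  refine ⟨fun i => ⟨_, hu i⟩, k, hk, ?_⟩
  filter_upwards [c.eventually_coord_param] with e he s x
  rw [← sub_eq_iff_eq_add', hH_sub s (c.coord x) e, ← b.sum_repr (c.coord x - e), map_sum]
  refine Finset.sum_congr rfl fun i _ => ?_
  simp [he, hk_apply]

/-- Hadamard's lemma on a manifold: away from `p`, where the coordinates are of no use, the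
difference is divided by a function that vanishes near `p`. -/
theorem exists_hadamard_manifold {f : S → SmoothFun E M} (hf : IsSmoothFamily S f) {p : M}
    (c : LocalCoordinates E p) :
    ∃ u : Option (Fin (Module.finrank ℝ E)) → SmoothFun E M,
    ∃ k : Option (Fin (Module.finrank ℝ E)) → S × E → SmoothFun E M,
      (∀ i, IsSmoothFamily (S × E) (k i)) ∧
      ∀ᶠ e in 𝓝 (c.coord p), ∀ s, f s = algebraMap ℂ _ ((f s : M → ℂ) (c.param e)) +
        ∑ i, (u i - algebraMap ℂ _ ((u i : M → ℂ) (c.param e))) * k i (s, e) := by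
  obtain ⟨u, k, hk, hfuk⟩ := exists_hadamard_coord hf c
  obtain ⟨a, ha_one, ha_zero⟩ :=
    exists_smoothFun_eventuallyEq_one (E := E) (p := p) c.eventually_param_coord
  have hk_none : ContMDiff (𝓘(ℝ, S × E).prod 𝓘(ℝ, E)) 𝓘(ℝ, ℂ) ∞ (Function.uncurry
      fun (q : S × E) x => (f q.1 : M → ℂ) x - (f q.1 : M → ℂ) (c.param (c.coord x))) := by
    have hfst : ContMDiff (𝓘(ℝ, S × E).prod 𝓘(ℝ, E)) 𝓘(ℝ, S) ∞
        (fun q : (S × E) × M => q.1.1) := contDiff_fst.contMDiff.comp contMDiff_fst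
    exact (ContMDiff.comp hf (hfst.prodMk contMDiff_snd)).sub (ContMDiff.comp hf (hfst.prodMk
      ((c.contMDiff_param.comp c.contMDiff_coord).comp contMDiff_snd)))
  obtain ⟨k₀, hk₀, hk₀_apply⟩ := exists_isSmoothFamily_of_contMDiff hk_none
  refine ⟨fun i => i.elim (1 - a) u, fun i => i.elim k₀ k, Option.rec hk₀ hk, ?_⟩
  filter_upwards [hfuk, c.tendsto_param.eventually ha_one] with e he hae s
  ext x
  have hsplit : (1 - (a : M → ℂ) x) *
        ((f s : M → ℂ) x - (f s : M → ℂ) (c.param (c.coord x))) =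
      (f s : M → ℂ) x - (f s : M → ℂ) (c.param (c.coord x)) := by
    by_cases hx : c.param (c.coord x) = x
    · simp [hx]
    · simp [ha_zero x hx]
  suffices (f s : M → ℂ) x = (f s : M → ℂ) (c.param e) +
      ((f s : M → ℂ) x - (f s : M → ℂ) (c.param (c.coord x)) +
        ∑ i, ((u i : M → ℂ) x - (u i : M → ℂ) (c.param e)) * (k i (s, e) : M → ℂ) x) by
    have hae : (a : M → ℂ) (c.param e) = 1 := hae
    simpa [Fintype.sum_option, hk₀_apply, hae, hsplit]
  linear_combination he s x

end Hadamard

section Action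

variable {E : Type*} [NormedAddCommGroup E] [NormedSpace ℝ E] [FiniteDimensional ℝ E]
  {M : Type*} [TopologicalSpace M] [T2Space M] [ChartedSpace E M] [IsManifold 𝓘(ℝ, E) ∞ M]

/-- The induction on the order enlarges the parameter space by a factor `E`, which forces the
universe of `S` to absorb that of `E`. -/
theorem isSmoothFamily_apply_of_mem_diffOpLT_aux.{u, v} {E : Type v} [NormedAddCommGroup E]
    [NormedSpace ℝ E] [FiniteDimensional ℝ E] {M : Type*} [TopologicalSpace M] [T2Space M]
    [ChartedSpace E M] [IsManifold 𝓘(ℝ, E) ∞ M] {S : Type (max u v)} [NormedAddCommGroup S]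
    [NormedSpace ℝ S] [FiniteDimensional ℝ S] (n : ℕ) {Q : S → Module.End ℂ (SmoothFun E M)}
    (hQ : ∀ s, Q s ∈ diffOpLT ℂ (SmoothFun E M) n) (hQs : ∀ g, IsSmoothFamily S (fun s => Q s g))
    {f : S → SmoothFun E M} (hf : IsSmoothFamily S f) :
    IsSmoothFamily S (fun s => Q s (f s)) := by
  induction n generalizing S with
  | zero => simpa [fun s => mem_diffOpLT_zero.1 (hQ s)] using isSmoothFamily_const 0
  | succ n ih =>
    refine isSmoothFamily_of_localCoordinates fun s₀ p => ?_
    obtain ⟨c⟩ : Nonempty (LocalCoordinates E p) := inferInstance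
    obtain ⟨u, k, hk, hfuk⟩ := exists_hadamard_manifold hf c
    refine ⟨LocalCoordinates.refl s₀, c, ?_⟩
    have hfst : ContMDiff 𝓘(ℝ, S × E) 𝓘(ℝ, S) ∞ (Prod.fst : S × E → S) := contDiff_fst.contMDiff
    have hparam : ContMDiff 𝓘(ℝ, S × E) 𝓘(ℝ, E) ∞ (fun q : S × E => c.param q.2) :=
      c.contMDiff_param.comp contDiff_snd.contMDiff
    have hcomm (i) : IsSmoothFamily (S × E)
        (fun q => ⁅Q q.1, LinearMap.mulLeft ℂ (u i)⁆ (k i q)) := by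
      refine ih (S := S × E) (Q := fun q => ⁅Q q.1, LinearMap.mulLeft ℂ (u i)⁆)
        (fun q => mem_diffOpLT_succ.1 (hQ q.1) (u i)) (fun g => ?_) (hk i)
      exact ((hQs (u i * g)).sub ((isSmoothFamily_const _).mul (hQs g))).comp hfst
    have hformula : ContDiff ℝ ∞ fun q : S × E =>
        (f q.1 : M → ℂ) (c.param q.2) * (Q q.1 1 : M → ℂ) (c.param q.2) +
          ∑ i, (⁅Q q.1, LinearMap.mulLeft ℂ (u i)⁆ (k i q) : M → ℂ) (c.param q.2) :=
      ((hf.contDiff_comp hfst hparam).mul ((hQs 1).contDiff_comp hfst hparam)).add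
        (ContDiff.sum fun i _ => (hcomm i).contDiff_comp contMDiff_id hparam)
    refine hformula.contDiffAt.congr_of_eventuallyEq ?_
    filter_upwards [hfuk.prod_inr_nhds s₀] with q hq
    change (Q q.1 (f q.1) : M → ℂ) (c.param q.2) = _
    conv_lhs => rw [hq q.1]
    rw [map_add, map_sum, Algebra.algebraMap_eq_smul_one, map_smul]
    simp only [AddMemClass.coe_add, AddSubmonoidClass.coe_finsetSum, Pi.add_apply,
      Finset.sum_apply, apply_sub_const_mul]
    rfl

variable {S : Type*} [NormedAddCommGroup S] [NormedSpace ℝ S] [FiniteDimensional ℝ S]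

theorem isSmoothFamily_apply_of_mem_diffOpLT {n : ℕ} {Q : S → Module.End ℂ (SmoothFun E M)}
    (hQ : ∀ s, Q s ∈ diffOpLT ℂ (SmoothFun E M) n) (hQs : ∀ g, IsSmoothFamily S (fun s => Q s g))
    {f : S → SmoothFun E M} (hf : IsSmoothFamily S f) :
    IsSmoothFamily S (fun s => Q s (f s)) := by
  have hfst : ContMDiff 𝓘(ℝ, S × E) 𝓘(ℝ, S) ∞ (Prod.fst : S × E → S) := contDiff_fst.contMDiff
  have hinl : ContMDiff 𝓘(ℝ, S) 𝓘(ℝ, S × E) ∞ (fun s : S => (s, (0 : E))) :=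
    (contDiff_id.prodMk contDiff_const).contMDiff
  exact (isSmoothFamily_apply_of_mem_diffOpLT_aux (S := S × E) n (fun q => hQ q.1)
    (fun g => (hQs g).comp hfst) (hf.comp hfst)).comp hinl

end Action

/-! ### Smooth families of differential operators -/

section OpFamily

variable {F : Type*} [NormedAddCommGroup F] [NormedSpace ℝ F]
  {T : Type*} [TopologicalSpace T] [ChartedSpace F T]
  {E : Type*} [NormedAddCommGroup E] [NormedSpace ℝ E]
  {M : Type*} [TopologicalSpace M] [ChartedSpace E M]

variable (F) in
/-- A smooth map from `T` to the differential operators on `M`: the order is bounded locally on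
`T`, and the operators depend smoothly on the parameter when applied to a fixed function. -/
structure IsSmoothOpFamily (Q : T → Module.End ℂ (SmoothFun E M)) : Prop where
  order : ∀ σ₀ : T, ∃ n : ℕ, ∀ᶠ σ in 𝓝 σ₀, Q σ ∈ diffOpLT ℂ (SmoothFun E M) n
  smooth_const : ∀ g, IsSmoothFamily F (fun σ => Q σ g)

namespace IsSmoothOpFamily

variable {P Q : T → Module.End ℂ (SmoothFun E M)}

theorem const {P : Module.End ℂ (SmoothFun E M)} {n : ℕ} (hP : P ∈ diffOpLT ℂ (SmoothFun E M) n) :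
    IsSmoothOpFamily F (fun _ : T => P) :=
  ⟨fun _ => ⟨n, Eventually.of_forall fun _ => hP⟩, fun g => isSmoothFamily_const (P g)⟩

theorem add (hP : IsSmoothOpFamily F P) (hQ : IsSmoothOpFamily F Q) :
    IsSmoothOpFamily F (fun σ => P σ + Q σ) := by
  refine ⟨fun σ₀ => ?_, fun g => isSmoothFamily_add (hP.smooth_const g) (hQ.smooth_const g)⟩
  obtain ⟨m, hm⟩ := hP.order σ₀
  obtain ⟨n, hn⟩ := hQ.order σ₀
  refine ⟨max m n, ?_⟩
  filter_upwards [hm, hn] with σ hPσ hQσ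
  exact add_mem (diffOpLT_mono _ _ (le_max_left m n) hPσ) (diffOpLT_mono _ _ (le_max_right m n) hQσ)

theorem sum {ι : Type*} (s : Finset ι) {P : ι → T → Module.End ℂ (SmoothFun E M)}
    (hP : ∀ i ∈ s, IsSmoothOpFamily F (P i)) : IsSmoothOpFamily F (fun σ => ∑ i ∈ s, P i σ) := by
  classical
  induction s using Finset.induction_on with
  | empty => simpa using const (zero_mem (diffOpLT ℂ (SmoothFun E M) 0))
  | insert i s hi ih =>
    simp only [Finset.sum_insert hi]
    exact (hP i (by simp)).add (ih fun j hj => hP j (by simp [hj]))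

variable [FiniteDimensional ℝ F] [T2Space T] [IsManifold 𝓘(ℝ, F) ∞ T]
  [FiniteDimensional ℝ E] [T2Space M] [IsManifold 𝓘(ℝ, E) ∞ M]

theorem smooth (hQ : IsSmoothOpFamily F Q) {f : T → SmoothFun E M} (hf : IsSmoothFamily F f) :
    IsSmoothFamily F (fun σ => Q σ (f σ)) := by
  refine isSmoothFamily_of_localCoordinates fun σ p => ?_
  obtain ⟨n, hn⟩ := hQ.order σ
  obtain ⟨b, hb⟩ := LocalCoordinates.exists_param_mem (E := F) hn
  obtain ⟨c⟩ : Nonempty (LocalCoordinates E p) := inferInstance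
  have hb_smooth := isSmoothFamily_apply_of_mem_diffOpLT hb
    (fun g => (hQ.smooth_const g).comp b.contMDiff_param) (hf.comp b.contMDiff_param)
  exact ⟨b, c, (hb_smooth.contDiff_comp contDiff_fst.contMDiff
    (c.contMDiff_param.comp contDiff_snd.contMDiff)).contDiffAt⟩

theorem mul (hP : IsSmoothOpFamily F P) (hQ : IsSmoothOpFamily F Q) :
    IsSmoothOpFamily F (fun σ => P σ * Q σ) := by
  refine ⟨fun σ₀ => ?_, fun g => hP.smooth (hQ.smooth_const g)⟩
  obtain ⟨m, hm⟩ := hP.order σ₀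
  obtain ⟨n, hn⟩ := hQ.order σ₀
  refine ⟨m + n, ?_⟩
  filter_upwards [hm, hn] with σ hPσ hQσ
  exact mul_mem_diffOpLT hPσ hQσ

end IsSmoothOpFamily

end OpFamily

section ProductRule

variable {E : Type*} [NormedAddCommGroup E] [NormedSpace ℝ E] [FiniteDimensional ℝ E]
  {M : Type*} [TopologicalSpace M] [T2Space M] [ChartedSpace E M] [IsManifold 𝓘(ℝ, E) ∞ M]

theorem contMDiff_dslope {f : ℝ → SmoothFun E M} (hf : IsSmoothFamily ℝ f) :
    ContMDiff (𝓘(ℝ, ℝ).prod 𝓘(ℝ, E)) 𝓘(ℝ, ℂ) ∞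
      (Function.uncurry fun (t : ℝ) x => dslope (fun t => (f t : M → ℂ) x) 0 t) := by
  rintro ⟨t₀, p⟩
  obtain ⟨c⟩ : Nonempty (LocalCoordinates E p) := inferInstance
  refine (LocalCoordinates.refl t₀).contMDiffAt_prod_of_contDiffAt c ?_
  have hf_param : ContDiff ℝ ∞ (fun q : E × ℝ => (f q.2 : M → ℂ) (c.param q.1)) :=
    hf.contDiff_comp contDiff_snd.contMDiff (c.contMDiff_param.comp contDiff_fst.contMDiff)
  obtain ⟨H, hH, hH_sub, hH_diag⟩ := exists_hadamard hf_param
  have hdslope (q : ℝ × E) :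
      dslope (fun t => (f t : M → ℂ) (c.param q.2)) 0 q.1 = H (q.2, q.1, 0) 1 := by
    obtain ⟨t, e⟩ := q
    rcases eq_or_ne t 0 with rfl | ht
    · simp [hH_diag]
    · rw [dslope_of_ne _ ht, slope_def_module, hH_sub e t 0, ← map_smul, sub_zero,
        smul_eq_mul, inv_mul_cancel₀ ht]
  simp only [LocalCoordinates.refl, Function.uncurry, hdslope, id]
  exact ((hH.comp (by fun_prop)).clm_apply contDiff_const).contDiffAt

theorem exists_dividedDifference {f : ℝ → SmoothFun E M} (hf : IsSmoothFamily ℝ f) :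
    ∃ w : ℝ → SmoothFun E M, IsSmoothFamily ℝ w ∧ (∀ t, f t = f 0 + (t : ℂ) • w t) ∧
      ∀ x, (w 0 : M → ℂ) x = deriv (fun t => (f t : M → ℂ) x) 0 := by
  obtain ⟨w, hw, hw_apply⟩ := exists_isSmoothFamily_of_contMDiff (contMDiff_dslope hf)
  refine ⟨w, hw, fun t => ?_, fun x => by rw [hw_apply, dslope_same]⟩
  ext x
  have hslope := sub_smul_dslope (fun t => (f t : M → ℂ) x) 0 t
  rw [sub_zero, Complex.real_smul, ← hw_apply] at hslope
  exact sub_eq_iff_eq_add'.1 hslope.symm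

variable {F : Type*} [NormedAddCommGroup F] [NormedSpace ℝ F] [FiniteDimensional ℝ F]
  {T : Type*} [TopologicalSpace T] [T2Space T] [ChartedSpace F T] [IsManifold 𝓘(ℝ, F) ∞ T]

theorem IsSmoothOpFamily.mvfderiv_apply {Q : T → Module.End ℂ (SmoothFun E M)}
    (hQ : IsSmoothOpFamily F Q) {f : T → SmoothFun E M} (hf : IsSmoothFamily F f)
    (V : SmoothVectorField F T) (σ : T) (x : M) :
    mvfderiv 𝓘(ℝ, F) (fun τ => (Q τ (f τ) : M → ℂ) x) σ (V σ) =
      mvfderiv 𝓘(ℝ, F) (fun τ => (Q τ (f σ) : M → ℂ) x) σ (V σ) +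
        (Q σ (derivAlong V f hf σ) : M → ℂ) x := by
  obtain ⟨n, hn⟩ := hQ.order σ
  obtain ⟨γ, hγ, hγn, hγ0, hγd⟩ := exists_curve (E := F) (V σ) hn
  obtain ⟨w, hw, hfw, hw0⟩ := exists_dividedDifference (hf.comp hγ)
  have hw0 : w 0 = derivAlong V f hf σ := by
    ext y
    rw [hw0]
    exact (hγd _ (hf.mdifferentiable y σ)).deriv
  have hQf : (fun t => (Q (γ t) (f (γ t)) : M → ℂ) x) = (fun t => (Q (γ t) (f σ) : M → ℂ) x) +
      ((fun t : ℝ => ((id t : ℝ) : ℂ)) * fun t => (Q (γ t) (w t) : M → ℂ) x) := by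
    ext t
    rw [hfw t, map_add, map_smul, hγ0]
    rfl
  have hQw : ContDiff ℝ ∞ (fun t => (Q (γ t) (w t) : M → ℂ) x) :=
    (isSmoothFamily_apply_of_mem_diffOpLT hγn (fun g => (hQ.smooth_const g).comp hγ)
      hw).contDiff_comp contMDiff_id contMDiff_const
  have hderiv_const := hγd _ ((hQ.smooth_const (f σ)).mdifferentiable x σ)
  have hderiv_mul := ((hasDerivAt_id (0 : ℝ)).ofReal_comp).mul
    ((hQw.differentiable (by simp) 0).hasDerivAt)
  have hderiv := hγd _ ((hQ.smooth hf).mdifferentiable x σ)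
  rw [hQf] at hderiv
  rw [hderiv.unique (hderiv_const.add hderiv_mul)]
  simp [hγ0, hw0]

end ProductRule

/-! ### Smooth families with prescribed derivative -/

namespace LocalCoordinates

variable {F : Type*} [NormedAddCommGroup F] [NormedSpace ℝ F]
  {T : Type*} [TopologicalSpace T] [ChartedSpace F T] {σ₀ : T}

/-- The coordinates `c` with inverse precomposed with a map `θ` that is the identity near the
centre. -/
def restrict (c : LocalCoordinates F σ₀) {θ : F → F} (hθ : ContDiff ℝ ∞ θ)
    (hθ_id : θ =ᶠ[𝓝 (c.coord σ₀)] id) : LocalCoordinates F σ₀ where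
  coord := c.coord
  param := c.param ∘ θ
  contMDiff_coord := c.contMDiff_coord
  contMDiff_param := c.contMDiff_param.comp hθ.contMDiff
  eventually_param_coord := by
    filter_upwards [c.eventually_param_coord,
      (c.contMDiff_coord.continuous.tendsto σ₀).eventually hθ_id] with σ hσ hθσ
    simpa [hθσ] using hσ
  eventually_coord_param := by
    filter_upwards [c.eventually_coord_param, hθ_id] with e he hθe
    simpa [hθe] using he

variable [FiniteDimensional ℝ F] [T2Space T] [IsManifold 𝓘(ℝ, F) ∞ T]

theorem exists_vectorField (c : LocalCoordinates F σ₀) (v : F) :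
    ∃ V : SmoothVectorField F T, ∀ᶠ w in 𝓝 (c.coord σ₀),
      V (c.param w) = mfderiv 𝓘(ℝ, F) 𝓘(ℝ, F) c.param w v := by
  obtain ⟨U, hU_sub, hU_open, hσ₀U⟩ := mem_nhds_iff.1 c.eventually_param_coord
  let s : ∀ σ : T, TangentSpace 𝓘(ℝ, F) σ := fun σ =>
    mfderiv 𝓘(ℝ, F) 𝓘(ℝ, F) c.param (c.coord σ) v
  have hpush : ContMDiff 𝓘(ℝ, F) 𝓘(ℝ, F).tangent ∞ (fun σ : T =>
      tangentMap 𝓘(ℝ, F) 𝓘(ℝ, F) c.param (⟨c.coord σ, v⟩ : TangentBundle 𝓘(ℝ, F) F)) := by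
    have hconst : ContMDiff 𝓘(ℝ, F) 𝓘(ℝ, F).tangent ∞
        (fun w : F => (⟨w, v⟩ : TangentBundle 𝓘(ℝ, F) F)) :=
      contMDiff_vectorSpace_iff_contDiff.2 contDiff_const
    exact (c.contMDiff_param.contMDiff_tangentMap (m := ∞) (by simp)).comp
      (hconst.comp c.contMDiff_coord)
  have hs : ContMDiffOn 𝓘(ℝ, F) 𝓘(ℝ, F).tangent ∞
      (fun σ : T => (⟨σ, s σ⟩ : TangentBundle 𝓘(ℝ, F) T)) U := by
    refine hpush.contMDiffOn.congr fun σ hσ => ?_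
    exact congrArg (fun τ => (⟨τ, (s σ : F)⟩ : TangentBundle 𝓘(ℝ, F) T)) (hU_sub hσ).symm
  obtain ⟨χ, hχ⟩ : ∃ χ : SmoothBumpFunction 𝓘(ℝ, F) σ₀, tsupport χ ⊆ U := by
    have := (SmoothBumpFunction.nhds_basis_tsupport (I := 𝓘(ℝ, F)) σ₀).mem_iff.1
      (hU_open.mem_nhds hσ₀U)
    simpa using this
  have hV : ContMDiff 𝓘(ℝ, F) 𝓘(ℝ, F).tangent ∞
      (fun σ : T => (⟨σ, χ σ • s σ⟩ : TangentBundle 𝓘(ℝ, F) T)) :=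
    ContMDiffOn.smul_section_of_tsupport χ.contMDiff.contMDiffOn hU_open hχ hs
  refine ⟨⟨fun σ => χ σ • s σ, hV⟩, ?_⟩
  filter_upwards [c.tendsto_param.eventually χ.eventuallyEq_one, c.eventually_coord_param]
    with w hχw hw
  rw [hχw, Pi.one_apply, one_smul]
  exact congrArg (fun z : F => (show F →L[ℝ] F from mfderiv 𝓘(ℝ, F) 𝓘(ℝ, F) c.param z) v) hw

variable (σ₀) in
theorem exists_mfderiv_param_eq_sum :
    ∃ (c : LocalCoordinates F σ₀) (d : ℕ) (V : Fin d → SmoothVectorField F T)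
      (a : Fin d → F → F →L[ℝ] ℝ), (∀ i, ContDiff ℝ ∞ (a i)) ∧
      ∀ w v, mfderiv 𝓘(ℝ, F) 𝓘(ℝ, F) c.param w v = ∑ i, a i w v • V i (c.param w) := by
  obtain ⟨c⟩ : Nonempty (LocalCoordinates F σ₀) := inferInstance
  let b := Module.finBasis ℝ F
  choose V hV using fun i => c.exists_vectorField (b i)
  obtain ⟨θ, hθ, hθ_id, hθV⟩ := exists_contDiff_eventuallyEq_id (eventually_all.2 hV)
  refine ⟨c.restrict hθ hθ_id, _, V,
    fun i w => (LinearMap.toContinuousLinearMap (b.coord i)).comp (fderiv ℝ θ w),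
    fun i => contDiff_const.clm_comp (hθ.fderiv_right (by simp)), fun w v => ?_⟩
  have hchain : mfderiv 𝓘(ℝ, F) 𝓘(ℝ, F) (c.restrict hθ hθ_id).param w v =
      mfderiv 𝓘(ℝ, F) 𝓘(ℝ, F) c.param (θ w) (fderiv ℝ θ w v) := by
    rw [← mfderiv_eq_fderiv]
    exact mfderiv_comp_apply w (c.contMDiff_param.mdifferentiable (by simp) _)
      (hθ.contMDiff.mdifferentiable (by simp) w) v
  rw [hchain]
  conv_lhs => rw [← b.sum_repr (fderiv ℝ θ w v)]
  refine (map_sum (mfderiv 𝓘(ℝ, F) 𝓘(ℝ, F) c.param (θ w)) _ _).trans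
    (Finset.sum_congr rfl fun i _ => ?_)
  exact (map_smul (mfderiv 𝓘(ℝ, F) 𝓘(ℝ, F) c.param (θ w)) _ _).trans
    (congrArg _ (hθV w i).symm)

end LocalCoordinates

section BasePoint

variable {T : Type*} [TopologicalSpace T]

/-- A chosen point in the connected component of `σ`; it serves to normalise primitives. -/
def basePoint (σ : T) : T := Quotient.out (σ : ConnectedComponents T)

theorem basePoint_mem_connectedComponent (σ : T) : basePoint σ ∈ connectedComponent σ :=
  ConnectedComponents.coe_eq_coe'.1 (Quotient.out_eq (σ : ConnectedComponents T))

theorem basePoint_eq_of_mem_connectedComponent {σ τ : T} (h : τ ∈ connectedComponent σ) :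
    basePoint τ = basePoint σ := by
  unfold basePoint
  rw [ConnectedComponents.coe_eq_coe'.2 h]

theorem basePoint_basePoint (σ : T) : basePoint (basePoint σ) = basePoint σ :=
  basePoint_eq_of_mem_connectedComponent (basePoint_mem_connectedComponent σ)

theorem forall_of_forall_basePoint {p : T → Prop} (hp : ∀ σ₀, ∀ᶠ σ in 𝓝 σ₀, (p σ ↔ p σ₀))
    (hb : ∀ σ, p (basePoint σ)) (σ : T) : p σ := by
  have hp_const : IsLocallyConstant p :=
    (IsLocallyConstant.iff_eventually_eq p).2 fun σ₀ => (hp σ₀).mono fun σ h => propext h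
  exact hp_const.apply_eq_of_isPreconnected isPreconnected_connectedComponent
    (basePoint_mem_connectedComponent σ) mem_connectedComponent ▸ hb σ

theorem eventually_basePoint_eq [LocallyConnectedSpace T] (σ₀ : T) :
    ∀ᶠ σ in 𝓝 σ₀, basePoint σ = basePoint σ₀ :=
  mem_of_superset (isOpen_connectedComponent.mem_nhds mem_connectedComponent) fun _ hσ =>
    basePoint_eq_of_mem_connectedComponent hσ

end BasePoint

section Primitive

variable {F : Type*} [NormedAddCommGroup F] [NormedSpace ℝ F] [FiniteDimensional ℝ F]
  {T : Type*} [TopologicalSpace T] [T2Space T] [ChartedSpace F T] [IsManifold 𝓘(ℝ, F) ∞ T]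

theorem exists_vectorField_apply_eq {σ : T} (v : TangentSpace 𝓘(ℝ, F) σ) :
    ∃ V : SmoothVectorField F T, V σ = v := by
  obtain ⟨c⟩ : Nonempty (LocalCoordinates F σ) := inferInstance
  obtain ⟨V, hV⟩ := c.exists_vectorField (mfderiv 𝓘(ℝ, F) 𝓘(ℝ, F) c.coord σ v)
  have hid : c.param ∘ c.coord =ᶠ[𝓝 σ] id := c.eventually_param_coord
  have chain := mfderiv_comp_apply σ (c.contMDiff_param.mdifferentiable (by simp) _)
    (c.contMDiff_coord.mdifferentiable (by simp) σ) v
  rw [hid.mfderiv_eq, mfderiv_id] at chain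
  have hVσ : (V (c.param (c.coord σ)) : F) = V σ := congrArg (fun τ => (V τ : F)) c.param_coord
  exact ⟨V, hVσ.symm.trans (hV.self_of_nhds.trans chain.symm)⟩

variable {Y : Type*} [NormedAddCommGroup Y] [NormedSpace ℝ Y]

variable (Y) in
theorem exists_mem_nhds_eq_of_mvfderiv_eq_zero (σ₀ : T) {U : Set T} (hU : U ∈ 𝓝 σ₀) :
    ∃ W ∈ 𝓝 σ₀, ∀ h : T → Y, MDifferentiable 𝓘(ℝ, F) 𝓘(ℝ, Y) h →
      (∀ σ ∈ U, ∀ v, mvfderiv 𝓘(ℝ, F) h σ v = 0) → ∀ σ ∈ W, h σ = h σ₀ := by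
  obtain ⟨c, hcU⟩ := LocalCoordinates.exists_param_mem (E := F) hU
  refine ⟨_, c.eventually_param_coord, fun h hh h0 σ hσ => ?_⟩
  have hc : MDifferentiable 𝓘(ℝ, F) 𝓘(ℝ, F) c.param := c.contMDiff_param.mdifferentiable (by simp)
  have hfderiv : ∀ w, fderiv ℝ (h ∘ c.param) w = 0 := fun w => by
    ext v
    rw [← mfderiv_eq_fderiv]
    exact (mfderiv_comp_apply w (hh _) (hc w) v).trans (h0 _ (hcU w) _)
  have hconst := is_const_of_fderiv_eq_zero (hh.comp hc).differentiable hfderiv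
    (c.coord σ) (c.coord σ₀)
  rwa [Function.comp_apply, Function.comp_apply, c.param_coord,
    show c.param (c.coord σ) = σ from hσ] at hconst

theorem eq_basePoint_of_mvfderiv_eq_zero {h : T → Y} (hh : MDifferentiable 𝓘(ℝ, F) 𝓘(ℝ, Y) h)
    (h0 : ∀ σ v, mvfderiv 𝓘(ℝ, F) h σ v = 0) (σ : T) : h σ = h (basePoint σ) := by
  have : LocallyConnectedSpace T := ChartedSpace.locallyConnectedSpace F T
  refine forall_of_forall_basePoint (p := fun σ => h σ = h (basePoint σ)) (fun σ₀ => ?_)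
    (fun σ => by rw [basePoint_basePoint]) σ
  obtain ⟨W, hW, hWh⟩ := exists_mem_nhds_eq_of_mvfderiv_eq_zero (F := F) Y σ₀ univ_mem
  filter_upwards [hW, eventually_basePoint_eq σ₀] with σ hσW hσ
  rw [hWh h hh (fun σ _ v => h0 σ v) σ hσW, hσ]

variable {E : Type*} [NormedAddCommGroup E] [NormedSpace ℝ E] [FiniteDimensional ℝ E]
  {M : Type*} [TopologicalSpace M] [T2Space M] [ChartedSpace E M] [IsManifold 𝓘(ℝ, E) ∞ M]
  {h : T → M → ℂ} {B : ∀ σ : T, TangentSpace 𝓘(ℝ, F) σ →ₗ[ℝ] SmoothFun E M}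

theorem exists_isSmoothFamily_integral {k : F × ℝ → SmoothFun E M}
    (hk : IsSmoothFamily (F × ℝ) k) :
    ∃ I : F → SmoothFun E M, IsSmoothFamily F I ∧
      ∀ w x, (I w : M → ℂ) x = ∫ t in (0 : ℝ)..1, (k (w, t) : M → ℂ) x := by
  refine exists_isSmoothFamily_of_contMDiff
    (f := fun w x => ∫ t in (0 : ℝ)..1, (k (w, t) : M → ℂ) x) ?_
  rintro ⟨w, x⟩
  obtain ⟨c⟩ : Nonempty (LocalCoordinates E x) := inferInstance
  refine (LocalCoordinates.refl w).contMDiffAt_prod_of_contDiffAt c (ContDiff.contDiffAt ?_)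
  refine contDiff_parametric_integral
    (f := fun (p : F × E) t => (k (p.1, t) : M → ℂ) (c.param p.2)) ?_
  have htime : ContDiff ℝ ∞ (fun q : (F × E) × ℝ => (q.1.1, q.2)) := by fun_prop
  have hspace : ContDiff ℝ ∞ (fun q : (F × E) × ℝ => q.1.2) := by fun_prop
  exact hk.contDiff_comp htime.contMDiff (c.contMDiff_param.comp hspace.contMDiff)

theorem exists_local_primitive
    (hB : ∀ V : SmoothVectorField F T, IsSmoothFamily F (fun σ => B σ (V σ)))
    (hd : ∀ x, MDifferentiable 𝓘(ℝ, F) 𝓘(ℝ, ℂ) (fun σ => h σ x))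
    (hBd : ∀ x σ v, mvfderiv 𝓘(ℝ, F) (fun τ => h τ x) σ v = (B σ v : M → ℂ) x) (σ₀ : T) :
    ∃ (c : LocalCoordinates F σ₀) (I : F → SmoothFun E M), IsSmoothFamily F I ∧
      ∀ w x, h (c.param w) x = h σ₀ x + (I w : M → ℂ) x := by
  obtain ⟨c, d, V, a, ha, hV⟩ := LocalCoordinates.exists_mfderiv_param_eq_sum (F := F) σ₀
  let w₀ := c.coord σ₀
  let ray : F × ℝ → F := fun q => w₀ + q.2 • (q.1 - w₀)
  have hray : ContDiff ℝ ∞ ray := by fun_prop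
  let k : F × ℝ → SmoothFun E M := fun q =>
    ∑ i, a i (ray q) (q.1 - w₀) • B (c.param (ray q)) (V i (c.param (ray q)))
  have hk : IsSmoothFamily (F × ℝ) k := by
    refine isSmoothFamily_sum _ fun i _ => IsSmoothFamily.smul
      (ContDiff.contMDiff (((ha i).comp hray).clm_apply (by fun_prop)))
      ((hB (V i)).comp (c.contMDiff_param.comp hray.contMDiff))
  have hc : MDifferentiable 𝓘(ℝ, F) 𝓘(ℝ, F) c.param := c.contMDiff_param.mdifferentiable (by simp)
  have hfderiv : ∀ w x t, fderiv ℝ ((fun τ => h τ x) ∘ c.param) (ray (w, t)) (w - w₀) =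
      (k (w, t) : M → ℂ) x := fun w x t => by
    rw [← mfderiv_eq_fderiv]
    refine ((mfderiv_comp_apply (ray (w, t)) (hd x _) (hc _) (w - w₀)).trans (hBd x _ _)).trans ?_
    refine (congrArg (fun u => (B _ u : M → ℂ) x) (hV (ray (w, t)) (w - w₀))).trans ?_
    simp only [map_sum, map_smul, k]
  obtain ⟨I, hI, hIk⟩ := exists_isSmoothFamily_integral hk
  refine ⟨c, I, hI, fun w x => ?_⟩
  have hk_cont : Continuous fun t : ℝ => (k (w, t) : M → ℂ) x :=
    (hk.contDiff_comp (ψ := fun t : ℝ => (w, t)) (χ := fun _ => x)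
      (ContDiff.contMDiff (by fun_prop)) contMDiff_const).continuous
  have hint := sub_eq_integral_fderiv ((hd x).comp hc).differentiable w w₀
    (by simpa only [← hfderiv] using hk_cont)
  rw [hIk, ← sub_eq_iff_eq_add']
  simpa only [← hfderiv, Function.comp_apply, w₀, c.param_coord] using hint

theorem contMDiff_of_mvfderiv_eq
    (hB : ∀ V : SmoothVectorField F T, IsSmoothFamily F (fun σ => B σ (V σ)))
    (hd : ∀ x, MDifferentiable 𝓘(ℝ, F) 𝓘(ℝ, ℂ) (fun σ => h σ x))
    (hBd : ∀ x σ v, mvfderiv 𝓘(ℝ, F) (fun τ => h τ x) σ v = (B σ v : M → ℂ) x)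
    (hb : ∀ σ, ContMDiff 𝓘(ℝ, E) 𝓘(ℝ, ℂ) ∞ (h (basePoint σ))) :
    ContMDiff (𝓘(ℝ, F).prod 𝓘(ℝ, E)) 𝓘(ℝ, ℂ) ∞ (Function.uncurry h) := by
  have hslice : ∀ σ, ContMDiff 𝓘(ℝ, E) 𝓘(ℝ, ℂ) ∞ (h σ) := by
    refine forall_of_forall_basePoint (fun σ₀ => ?_) hb
    obtain ⟨c, I, -, hI⟩ := exists_local_primitive hB hd hBd σ₀
    filter_upwards [c.eventually_param_coord] with σ hσ
    have hI_slice : ContMDiff 𝓘(ℝ, E) 𝓘(ℝ, ℂ) ∞ (I (c.coord σ) : M → ℂ) := (I (c.coord σ)).2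
    have hIσ := hI (c.coord σ)
    rw [hσ] at hIσ
    exact ⟨fun hs => (hs.sub hI_slice).congr fun x => by simp [hIσ x],
      fun hs => (hs.add hI_slice).congr fun x => by simp [hIσ x]⟩
  rintro ⟨σ₀, x₀⟩
  obtain ⟨c, I, hI_smooth, hI⟩ := exists_local_primitive hB hd hBd σ₀
  have hsum : ContMDiff (𝓘(ℝ, F).prod 𝓘(ℝ, E)) 𝓘(ℝ, ℂ) ∞
      (fun p : T × M => h σ₀ p.2 + (I (c.coord p.1) : M → ℂ) p.2) :=
    ((hslice σ₀).comp contMDiff_snd).add (hI_smooth.comp c.contMDiff_coord)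
  refine hsum.contMDiffAt.congr_of_eventuallyEq ?_
  filter_upwards [c.eventually_param_coord.prod_inl_nhds x₀] with p hp
  rw [← hI, hp, Function.uncurry]

end Primitive

/-! ### Primitives of closed forms -/

section ClosedForms

variable {F : Type*} [NormedAddCommGroup F] [NormedSpace ℝ F]
  {T : Type*} [TopologicalSpace T] [ChartedSpace F T]
  {Y : Type*} [NormedAddCommGroup Y] [NormedSpace ℝ Y]

/-- The differentiable map `p` is a primitive of the `1`-form `B`, that is `dp = B`. -/
structure IsPrimitive (p : T → Y) (B : ∀ σ : T, TangentSpace 𝓘(ℝ, F) σ → Y) : Prop where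
  mdifferentiable : MDifferentiable 𝓘(ℝ, F) 𝓘(ℝ, Y) p
  mvfderiv_apply : ∀ σ v, mvfderiv 𝓘(ℝ, F) p σ v = B σ v

namespace IsPrimitive

variable {p q : T → Y} {A B : ∀ σ : T, TangentSpace 𝓘(ℝ, F) σ → Y}

theorem const (c : Y) :
    IsPrimitive (fun _ : T => c) (fun (σ : T) (_ : TangentSpace 𝓘(ℝ, F) σ) => 0) :=
  ⟨mdifferentiable_const, fun σ v => by rw [mvfderiv_const]; rfl⟩

theorem add (hp : IsPrimitive p A) (hq : IsPrimitive q B) :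
    IsPrimitive (fun σ => p σ + q σ) (fun σ v => A σ v + B σ v) where
  mdifferentiable := hp.mdifferentiable.add hq.mdifferentiable
  mvfderiv_apply σ v := by
    rw [← hp.mvfderiv_apply, ← hq.mvfderiv_apply]
    exact congrArg (fun L : TangentSpace 𝓘(ℝ, F) σ →L[ℝ] Y => L v)
      (mvfderiv_add (hp.mdifferentiable σ) (hq.mdifferentiable σ))

theorem sub (hp : IsPrimitive p A) (hq : IsPrimitive q B) :
    IsPrimitive (fun σ => p σ - q σ) (fun σ v => A σ v - B σ v) where
  mdifferentiable := hp.mdifferentiable.sub hq.mdifferentiable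
  mvfderiv_apply σ v := by
    rw [← hp.mvfderiv_apply, ← hq.mvfderiv_apply]
    exact congrArg (fun L : TangentSpace 𝓘(ℝ, F) σ →L[ℝ] Y => L v)
      (mvfderiv_sub (hp.mdifferentiable σ) (hq.mdifferentiable σ))

theorem clm_comp {Z : Type*} [NormedAddCommGroup Z] [NormedSpace ℝ Z] (L : Y →L[ℝ] Z)
    (hp : IsPrimitive p A) : IsPrimitive (fun σ => L (p σ)) (fun σ v => L (A σ v)) where
  mdifferentiable σ := L.differentiableAt.mdifferentiableAt.comp σ (hp.mdifferentiable σ)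
  mvfderiv_apply σ v := by
    rw [← hp.mvfderiv_apply]
    have hchain := mfderiv_comp_apply (I' := 𝓘(ℝ, Y)) (I'' := 𝓘(ℝ, Z)) (g := L) σ
      L.differentiableAt.mdifferentiableAt (hp.mdifferentiable σ) v
    rwa [mfderiv_eq_fderiv, L.fderiv] at hchain

theorem const_mul {p : T → ℂ} {A : ∀ σ : T, TangentSpace 𝓘(ℝ, F) σ → ℂ} (c : ℂ)
    (hp : IsPrimitive p A) : IsPrimitive (fun σ => c * p σ) (fun σ v => c * A σ v) :=
  hp.clm_comp (ContinuousLinearMap.mul ℝ ℂ c)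

theorem sub_basePoint (hp : IsPrimitive p A) :
    IsPrimitive (fun σ => p σ - p (basePoint σ)) A := by
  have : LocallyConnectedSpace T := ChartedSpace.locallyConnectedSpace F T
  have hlocal : ∀ σ₀, (fun σ => p (basePoint σ)) =ᶠ[𝓝 σ₀] fun _ => p (basePoint σ₀) := fun σ₀ =>
    (eventually_basePoint_eq σ₀).mono fun σ hσ => congrArg p hσ
  have hbase : IsPrimitive (fun σ => p (basePoint σ))
      (fun (σ : T) (_ : TangentSpace 𝓘(ℝ, F) σ) => 0) := by
    refine ⟨fun σ => mdifferentiableAt_const.congr_of_eventuallyEq (hlocal σ), fun σ v => ?_⟩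
    rw [← (const (F := F) (p (basePoint σ))).mvfderiv_apply σ v]
    exact congrArg (fun L : TangentSpace 𝓘(ℝ, F) σ →L[ℝ] Y => L v) (hlocal σ).mfderiv_eq
  simpa only [sub_zero] using hp.sub hbase

theorem eq_of_basePoint [FiniteDimensional ℝ F] [T2Space T] [IsManifold 𝓘(ℝ, F) ∞ T]
    (hp : IsPrimitive p A) (hq : IsPrimitive q A)
    (hpq : ∀ σ, p (basePoint σ) = q (basePoint σ)) (σ : T) : p σ = q σ := by
  have hsub := hp.sub hq
  have hconst := eq_basePoint_of_mvfderiv_eq_zero hsub.mdifferentiable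
    (fun σ v => (hsub.mvfderiv_apply σ v).trans (sub_self _)) σ
  rwa [hpq, sub_self, sub_eq_zero] at hconst

end IsPrimitive

variable [FiniteDimensional ℝ F] [IsManifold 𝓘(ℝ, F) ∞ T]

/-- Smooth closed `1`-forms on `T` with values in `Y`, in terms of their values on vector fields;
for `Y = ℝ` these are the elements of `closedForms F T`. -/
structure IsSmoothClosed (B : ∀ σ : T, TangentSpace 𝓘(ℝ, F) σ → Y) : Prop where
  linear : ∀ σ, IsLinearMap ℝ (B σ)
  smooth : ∀ V : SmoothVectorField F T, ContMDiff 𝓘(ℝ, F) 𝓘(ℝ, Y) ∞ (fun σ => B σ (V σ))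
  closed : ∀ (V W : SmoothVectorField F T) (σ : T),
    mvfderiv 𝓘(ℝ, F) (fun τ => B τ (W τ)) σ (V σ) - mvfderiv 𝓘(ℝ, F) (fun τ => B τ (V τ)) σ (W σ)
      - B σ (V.bracket W σ) = 0

namespace IsSmoothClosed

theorem clm_comp {Z : Type*} [NormedAddCommGroup Z] [NormedSpace ℝ Z] (L : Y →L[ℝ] Z)
    {B : ∀ σ : T, TangentSpace 𝓘(ℝ, F) σ → Y} (hB : IsSmoothClosed B) :
    IsSmoothClosed (fun σ v => L (B σ v)) where
  linear σ := ⟨fun v w => by rw [(hB.linear σ).map_add, map_add],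
    fun c v => by rw [(hB.linear σ).map_smul, map_smul]⟩
  smooth V := L.contDiff.contMDiff.comp (hB.smooth V)
  closed V W σ := by
    have hL : ∀ (U : SmoothVectorField F T) (v : TangentSpace 𝓘(ℝ, F) σ),
        mvfderiv 𝓘(ℝ, F) (fun τ => L (B τ (U τ))) σ v =
          L (mvfderiv 𝓘(ℝ, F) (fun τ => B τ (U τ)) σ v) := fun U v =>
      (IsPrimitive.clm_comp L
        ⟨(hB.smooth U).mdifferentiable (by simp), fun _ _ => rfl⟩).mvfderiv_apply σ v
    rw [hL, hL, ← map_sub, ← map_sub, hB.closed, map_zero]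

theorem exists_isPrimitive_real (hT : Subsingleton (deRhamH1 F T))
    {B : ∀ σ : T, TangentSpace 𝓘(ℝ, F) σ → ℝ} (hB : IsSmoothClosed B) :
    ∃ p : T → ℝ, IsPrimitive p B := by
  have : ∀ σ : T, FiniteDimensional ℝ (TangentSpace 𝓘(ℝ, F) σ) :=
    fun _ => inferInstanceAs (FiniteDimensional ℝ F)
  have : ∀ σ : T, T2Space (TangentSpace 𝓘(ℝ, F) σ) := fun _ => inferInstanceAs (T2Space F)
  let α : closedForms F T :=
    ⟨fun σ => LinearMap.toContinuousLinearMap ((hB.linear σ).mk' _), hB.smooth, hB.closed⟩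
  have hα : α ∈ (exactForms F T).comap (closedForms F T).subtype := by
    rw [Submodule.Quotient.subsingleton_iff.1 hT]
    trivial
  obtain ⟨p, hp, hpα⟩ := hα
  exact ⟨p, hp.mdifferentiable (by simp), fun σ v => (hpα σ v).symm⟩

theorem exists_isPrimitive (hT : Subsingleton (deRhamH1 F T))
    {B : ∀ σ : T, TangentSpace 𝓘(ℝ, F) σ → ℂ} (hB : IsSmoothClosed B) :
    ∃ p : T → ℂ, IsPrimitive p B := by
  obtain ⟨p, hp⟩ := (hB.clm_comp Complex.reCLM).exists_isPrimitive_real hT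
  obtain ⟨q, hq⟩ := (hB.clm_comp Complex.imCLM).exists_isPrimitive_real hT
  have hpq := (hp.clm_comp Complex.ofRealCLM).add
    ((hq.clm_comp Complex.ofRealCLM).const_mul Complex.I)
  refine ⟨_, hpq.mdifferentiable, fun σ v => (hpq.mvfderiv_apply σ v).trans ?_⟩
  rw [mul_comm]
  exact Complex.re_add_im (B σ v)

variable [T2Space T] {E : Type*} [NormedAddCommGroup E] [NormedSpace ℝ E] [FiniteDimensional ℝ E]
  {M : Type*} [TopologicalSpace M] [T2Space M] [ChartedSpace E M] [IsManifold 𝓘(ℝ, E) ∞ M]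

theorem exists_isSmoothFamily_isPrimitive (hT : Subsingleton (deRhamH1 F T))
    {B : ∀ σ : T, TangentSpace 𝓘(ℝ, F) σ → SmoothFun E M} (hB_linear : ∀ σ, IsLinearMap ℝ (B σ))
    (hB_smooth : ∀ V : SmoothVectorField F T, IsSmoothFamily F (fun σ => B σ (V σ)))
    (hB : ∀ x, IsSmoothClosed (fun σ v => (B σ v : M → ℂ) x)) :
    ∃ f : T → SmoothFun E M, IsSmoothFamily F f ∧
      (∀ x, IsPrimitive (fun σ => (f σ : M → ℂ) x) (fun σ v => (B σ v : M → ℂ) x)) ∧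
      ∀ σ, f (basePoint σ) = 0 := by
  choose q hq using fun x => (hB x).exists_isPrimitive hT
  let p : T → M → ℂ := fun σ x => q x σ - q x (basePoint σ)
  have hp : ∀ x, IsPrimitive (fun σ => p σ x) (fun σ v => (B σ v : M → ℂ) x) :=
    fun x => (hq x).sub_basePoint
  have hp_base : ∀ σ, p (basePoint σ) = 0 := fun σ => by
    ext x
    simp [p, basePoint_basePoint]
  have hp_smooth := contMDiff_of_mvfderiv_eq (B := fun σ => (hB_linear σ).mk' _) hB_smooth
    (fun x => (hp x).mdifferentiable) (fun x => (hp x).mvfderiv_apply)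
    (fun σ => by rw [hp_base]; exact contMDiff_const)
  obtain ⟨f, hf, hfp⟩ := exists_isSmoothFamily_of_contMDiff hp_smooth
  refine ⟨f, hf, fun x => by simpa only [hfp] using hp x, fun σ => Subtype.ext (funext fun x => ?_)⟩
  rw [hfp, hp_base]
  rfl

end IsSmoothClosed

end ClosedForms

section OpPrimitive

variable {F : Type*} [NormedAddCommGroup F] [NormedSpace ℝ F]
  {T : Type*} [TopologicalSpace T] [ChartedSpace F T]
  {E : Type*} [NormedAddCommGroup E] [NormedSpace ℝ E]
  {M : Type*} [TopologicalSpace M] [ChartedSpace E M]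

/-- The operator-valued form `B` is the derivative of the family `Q`, pointwise on `M` after
application to a fixed function. -/
def HasOpDeriv (Q : T → Module.End ℂ (SmoothFun E M))
    (B : ∀ σ : T, TangentSpace 𝓘(ℝ, F) σ → Module.End ℂ (SmoothFun E M)) : Prop :=
  ∀ (g : SmoothFun E M) (x : M),
    IsPrimitive (fun σ => (Q σ g : M → ℂ) x) (fun σ v => (B σ v g : M → ℂ) x)

variable {Q : T → Module.End ℂ (SmoothFun E M)}
  {B : ∀ σ : T, TangentSpace 𝓘(ℝ, F) σ → Module.End ℂ (SmoothFun E M)}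

theorem HasOpDeriv.lie_mulLeft (h : HasOpDeriv Q B) (u : SmoothFun E M) :
    HasOpDeriv (fun σ => ⁅Q σ, LinearMap.mulLeft ℂ u⁆)
      (fun σ v => ⁅B σ v, LinearMap.mulLeft ℂ u⁆) :=
  fun g x => (h (u * g) x).sub ((h g x).const_mul ((u : M → ℂ) x))

theorem HasOpDeriv.add_const (h : HasOpDeriv Q B) (P : Module.End ℂ (SmoothFun E M)) :
    HasOpDeriv (fun σ => Q σ + P) B := fun g x => by
  have hsum := (h g x).add (.const ((P g : M → ℂ) x))
  simp only [add_zero] at hsum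
  exact hsum

variable [FiniteDimensional ℝ F] [T2Space T] [IsManifold 𝓘(ℝ, F) ∞ T]

theorem HasOpDeriv.eventually_sub_mem_diffOpLT (h : HasOpDeriv Q B) {σ₀ : T} {n : ℕ}
    (hB : ∀ᶠ σ in 𝓝 σ₀, ∀ v, B σ v ∈ diffOpLT ℂ (SmoothFun E M) n) :
    ∀ᶠ σ in 𝓝 σ₀, Q σ - Q σ₀ ∈ diffOpLT ℂ (SmoothFun E M) n := by
  obtain ⟨W, hW, hW_const⟩ := exists_mem_nhds_eq_of_mvfderiv_eq_zero (F := F) ℂ σ₀ hB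
  filter_upwards [hW] with σ hσ
  generalize hU : {σ | ∀ v, B σ v ∈ diffOpLT ℂ (SmoothFun E M) n} = U at hW_const
  replace hU : ∀ τ ∈ U, ∀ v, B τ v ∈ diffOpLT ℂ (SmoothFun E M) n := fun τ hτ => hU.ge hτ
  clear hB
  induction n generalizing Q B with
  | zero =>
    rw [mem_diffOpLT_zero, sub_eq_zero]
    ext g x
    refine hW_const _ (h g x).mdifferentiable (fun τ hτ v => ?_) σ hσ
    rw [(h g x).mvfderiv_apply, mem_diffOpLT_zero.1 (hU τ hτ v)]
    rfl
  | succ n ih =>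
    refine mem_diffOpLT_succ.2 fun u => ?_
    rw [sub_lie]
    exact ih (h.lie_mulLeft u) (fun τ hτ v => mem_diffOpLT_succ.1 (hU τ hτ v) u)

theorem HasOpDeriv.exists_mem_diffOpLT (h : HasOpDeriv Q B)
    (hB : ∀ σ₀ : T, ∃ n : ℕ, ∀ᶠ σ in 𝓝 σ₀, ∀ v, B σ v ∈ diffOpLT ℂ (SmoothFun E M) n)
    (hQ : ∀ σ, ∃ n, Q (basePoint σ) ∈ diffOpLT ℂ (SmoothFun E M) n) (σ : T) :
    ∃ n, Q σ ∈ diffOpLT ℂ (SmoothFun E M) n := by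
  have : LocallyConnectedSpace T := ChartedSpace.locallyConnectedSpace F T
  refine forall_of_forall_basePoint
    (p := fun σ => ∃ n, Q σ ∈ diffOpLT ℂ (SmoothFun E M) n) (fun σ₀ => ?_) hQ σ
  obtain ⟨N, hN⟩ := hB σ₀
  filter_upwards [h.eventually_sub_mem_diffOpLT hN] with σ hσ
  have hle : ∀ {P n}, P ∈ diffOpLT ℂ (SmoothFun E M) n → P ∈ diffOpLT ℂ (SmoothFun E M) (max n N) :=
    fun hP => diffOpLT_mono _ _ (le_max_left _ _) hP
  have hσ' : ∀ n, Q σ - Q σ₀ ∈ diffOpLT ℂ (SmoothFun E M) (max n N) :=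
    fun n => diffOpLT_mono _ _ (le_max_right _ _) hσ
  exact ⟨fun ⟨n, hn⟩ => ⟨_, by simpa using sub_mem (hle hn) (hσ' n)⟩,
    fun ⟨n, hn⟩ => ⟨_, by simpa using add_mem (hle hn) (hσ' n)⟩⟩

theorem HasOpDeriv.isSmoothOpFamily (h : HasOpDeriv Q B)
    (hB : ∀ σ₀ : T, ∃ n : ℕ, ∀ᶠ σ in 𝓝 σ₀, ∀ v, B σ v ∈ diffOpLT ℂ (SmoothFun E M) n)
    (hQ : ∀ σ, ∃ n, Q (basePoint σ) ∈ diffOpLT ℂ (SmoothFun E M) n)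
    (hQ_smooth : ∀ g, IsSmoothFamily F (fun σ => Q σ g)) : IsSmoothOpFamily F Q where
  order σ₀ := by
    obtain ⟨N, hN⟩ := hB σ₀
    obtain ⟨n, hn⟩ := h.exists_mem_diffOpLT hB hQ σ₀
    refine ⟨max n N, ?_⟩
    filter_upwards [h.eventually_sub_mem_diffOpLT hN] with σ hσ
    rw [← add_sub_cancel (Q σ₀) (Q σ)]
    exact add_mem (diffOpLT_mono _ _ (le_max_left _ _) hn) (diffOpLT_mono _ _ (le_max_right _ _) hσ)
  smooth_const := hQ_smooth

/-- Smooth closed `1`-forms on `T` with values in the differential operators on `M`; the order of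
the operators is bounded locally on `T`. -/
structure IsClosedOpForm (B : ∀ σ : T, TangentSpace 𝓘(ℝ, F) σ → Module.End ℂ (SmoothFun E M)) :
    Prop where
  linear : ∀ σ, IsLinearMap ℝ (B σ)
  order : ∀ σ₀ : T, ∃ n : ℕ, ∀ᶠ σ in 𝓝 σ₀, ∀ v, B σ v ∈ diffOpLT ℂ (SmoothFun E M) n
  smooth : ∀ (V : SmoothVectorField F T) (g : SmoothFun E M),
    IsSmoothFamily F (fun σ => B σ (V σ) g)
  closed : ∀ (V W : SmoothVectorField F T) (g : SmoothFun E M) (x : M) (σ : T),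
    mvfderiv 𝓘(ℝ, F) (fun τ => (B τ (W τ) g : M → ℂ) x) σ (V σ)
      - mvfderiv 𝓘(ℝ, F) (fun τ => (B τ (V τ) g : M → ℂ) x) σ (W σ)
      - (B σ (V.bracket W σ) g : M → ℂ) x = 0

namespace IsClosedOpForm

variable [FiniteDimensional ℝ E] [T2Space M] [IsManifold 𝓘(ℝ, E) ∞ M]

theorem exists_hasOpDeriv (hT : Subsingleton (deRhamH1 F T)) (hB : IsClosedOpForm B) :
    ∃ R : T → Module.End ℂ (SmoothFun E M), HasOpDeriv R B ∧
      (∀ g, IsSmoothFamily F (fun σ => R σ g)) ∧ ∀ σ, R (basePoint σ) = 0 := by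
  have hB_linear : ∀ g σ, IsLinearMap ℝ fun v => B σ v g := fun g σ =>
    ⟨fun v w => by rw [(hB.linear σ).map_add]; rfl,
      fun c v => by rw [(hB.linear σ).map_smul]; rfl⟩
  choose r hr_smooth hr hr_base using fun g =>
    IsSmoothClosed.exists_isSmoothFamily_isPrimitive hT (hB_linear g) (hB.smooth · g) fun x =>
      ⟨fun σ => ⟨fun v w => by rw [(hB_linear g σ).map_add]; rfl,
        fun c v => by rw [(hB_linear g σ).map_smul]; rfl⟩,
      fun V => ContMDiff.comp (hB.smooth V g) (contMDiff_id.prodMk contMDiff_const),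
      fun V W σ => hB.closed V W g x σ⟩
  let R : T → Module.End ℂ (SmoothFun E M) := fun σ =>
    { toFun := fun g => r g σ
      map_add' := fun g g' => Subtype.ext <| funext fun x => by
        refine (hr (g + g') x).eq_of_basePoint (q := fun σ => (r g σ + r g' σ : SmoothFun E M).1 x)
          ?_ (fun σ => by simp only [hr_base, add_zero]) σ
        simp only [map_add]
        exact (hr g x).add (hr g' x)
      map_smul' := fun c g => Subtype.ext <| funext fun x => by
        refine (hr (c • g) x).eq_of_basePoint (q := fun σ => (c • r g σ : SmoothFun E M).1 x)
          ?_ (fun σ => by simp only [hr_base, smul_zero]) σ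
        simp only [map_smul]
        exact (hr g x).const_mul c }
  exact ⟨R, hr, hr_smooth, fun σ => LinearMap.ext fun g => hr_base g σ⟩

theorem exists_isSmoothOpFamily (hT : Subsingleton (deRhamH1 F T)) (hB : IsClosedOpForm B)
    {P₀ : Module.End ℂ (SmoothFun E M)} {n : ℕ} (hP₀ : P₀ ∈ diffOpLT ℂ (SmoothFun E M) n) :
    ∃ Q : T → Module.End ℂ (SmoothFun E M), IsSmoothOpFamily F Q ∧ HasOpDeriv Q B ∧
      ∀ σ, Q (basePoint σ) = P₀ := by
  obtain ⟨R, hR, hR_smooth, hR_base⟩ := hB.exists_hasOpDeriv hT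
  have hR_family : IsSmoothOpFamily F R :=
    hR.isSmoothOpFamily hB.order (fun σ => ⟨0, mem_diffOpLT_zero.2 (hR_base σ)⟩) hR_smooth
  exact ⟨fun σ => R σ + P₀, hR_family.add (.const hP₀), hR.add_const P₀,
    fun σ => by simp only [hR_base, zero_add]⟩

end IsClosedOpForm

end OpPrimitive

/-! ### Formal operators and formal sections -/

section FormalFamilies

variable {F : Type*} [NormedAddCommGroup F] [NormedSpace ℝ F]
  {T : Type*} [TopologicalSpace T] [ChartedSpace F T]
  {E : Type*} [NormedAddCommGroup E] [NormedSpace ℝ E]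
  {M : Type*} [TopologicalSpace M] [ChartedSpace E M]

variable (F) in
/-- A smooth map from `T` to the formal differential operators on `M`, encoded as power series in
`h` with operator coefficients. -/
def IsSmoothFormalOpFamily (G : T → PowerSeries (Module.End ℂ (SmoothFun E M))) : Prop :=
  ∀ n, IsSmoothOpFamily F (fun σ => PowerSeries.coeff n (G σ))

namespace FormalSection

theorem ext_apply {f g : FormalSection F T E M} (h : ∀ σ, f σ = g σ) : f = g := by
  cases f
  cases g
  congr
  exact funext h

variable (F T) in
/-- The section of the trivial bundle `T × C^∞(M)[[h]]` with constant value `f`. -/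
def const (f : FormalFun E M) : FormalSection F T E M where
  toFun _ := f
  smooth n := isSmoothFamily_const (PowerSeries.coeff n f)

end FormalSection

theorem mvfderiv_sum_apply {ι : Type*} (s : Finset ι) {f : ι → T → SmoothFun E M}
    (hf : ∀ i, IsSmoothFamily F (f i)) (σ : T) (v : TangentSpace 𝓘(ℝ, F) σ) (x : M) :
    mvfderiv 𝓘(ℝ, F) (fun τ => ((∑ i ∈ s, f i τ : SmoothFun E M) : M → ℂ) x) σ v =
      ∑ i ∈ s, mvfderiv 𝓘(ℝ, F) (fun τ => (f i τ : M → ℂ) x) σ v := by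
  classical
  induction s using Finset.induction_on with
  | empty =>
    simp only [Finset.sum_empty]
    exact congrArg (fun L : TangentSpace 𝓘(ℝ, F) σ →L[ℝ] ℂ => L v) (mvfderiv_const (0 : ℂ))
  | insert i s hi ih =>
    simp only [Finset.sum_insert hi, ← ih]
    exact congrArg (fun L : TangentSpace 𝓘(ℝ, F) σ →L[ℝ] ℂ => L v)
      (mvfderiv_add ((hf i).mdifferentiable x σ)
        ((isSmoothFamily_sum s fun j _ => hf j).mdifferentiable x σ))

variable [IsManifold 𝓘(ℝ, F) ∞ T] [IsManifold 𝓘(ℝ, E) ∞ M]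

namespace FormalSection

/-- The derivative `V[f]` of a section with respect to the trivial connection. -/
def deriv (V : SmoothVectorField F T) (f : FormalSection F T E M) : FormalSection F T E M where
  toFun σ := PowerSeries.mk fun n =>
    derivAlong V (fun τ => PowerSeries.coeff n (f τ)) (f.smooth n) σ
  smooth n := by
    simp only [PowerSeries.coeff_mk]
    exact contMDiff_derivAlong V (f.smooth n)

theorem coeff_deriv_apply (V : SmoothVectorField F T) (f : FormalSection F T E M) (n : ℕ) (σ : T)
    (x : M) : ((PowerSeries.coeff n (f.deriv V σ) : SmoothFun E M) : M → ℂ) x = mvfderiv 𝓘(ℝ, F)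
      (fun τ => ((PowerSeries.coeff n (f τ) : SmoothFun E M) : M → ℂ) x) σ (V σ) := by
  simp only [deriv, PowerSeries.coeff_mk]
  rfl

theorem deriv_const (V : SmoothVectorField F T) (f : FormalFun E M) (σ : T) :
    (const F T f).deriv V σ = 0 := by
  ext n x
  rw [coeff_deriv_apply]
  simp only [const, mvfderiv_const]
  rfl

end FormalSection

theorem FormalConnection.covDeriv_apply (D : FormalConnection F T E M) (V : SmoothVectorField F T)
    (f : FormalSection F T E M) (σ : T) :
    D.covDeriv V f σ = f.deriv V σ + formalAction (PowerSeries.mk (D.A σ (V σ))) (f σ) := by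
  rw [← formalApply_coeff]
  simp only [PowerSeries.coeff_mk]
  rfl

variable [FiniteDimensional ℝ F] [T2Space T] [FiniteDimensional ℝ E] [T2Space M]

namespace IsSmoothFormalOpFamily

variable {G H : T → PowerSeries (Module.End ℂ (SmoothFun E M))}

theorem mul (hG : IsSmoothFormalOpFamily F G) (hH : IsSmoothFormalOpFamily F H) :
    IsSmoothFormalOpFamily F (fun σ => G σ * H σ) := fun n => by
  simp only [PowerSeries.coeff_mul]
  exact .sum _ fun p _ => (hG p.1).mul (hH p.2)

theorem invOfUnit_one (hG : IsSmoothFormalOpFamily F G) :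
    IsSmoothFormalOpFamily F (fun σ => (G σ).invOfUnit 1) := fun n => by
  induction n using Nat.strong_induction_on with
  | _ n ih =>
    rw [show (fun σ => PowerSeries.coeff n ((G σ).invOfUnit 1)) = _ from
      funext fun σ => PowerSeries.coeff_invOfUnit n (G σ) 1]
    split_ifs with hn
    · exact .const one_mem_diffOpLT_one
    · refine (IsSmoothOpFamily.const (neg_mem one_mem_diffOpLT_one)).mul (.sum _ fun p _ => ?_)
      split_ifs with hp
      · exact (hG p.1).mul (ih p.2 hp)
      · exact .const (zero_mem (diffOpLT ℂ (SmoothFun E M) 0))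

/-- The action of a smooth family of formal operators on sections. -/
def act (hG : IsSmoothFormalOpFamily F G) (f : FormalSection F T E M) :
    FormalSection F T E M where
  toFun σ := formalAction (G σ) (f σ)
  smooth n := by
    simp only [coeff_formalAction]
    exact isSmoothFamily_sum _ fun p _ => (hG p.1).smooth (f.smooth p.2)

theorem act_apply (hG : IsSmoothFormalOpFamily F G) (f : FormalSection F T E M) (σ : T) :
    hG.act f σ = formalAction (G σ) (f σ) := rfl

theorem deriv_act (hG : IsSmoothFormalOpFamily F G)
    {B : ∀ σ : T, TangentSpace 𝓘(ℝ, F) σ → PowerSeries (Module.End ℂ (SmoothFun E M))}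
    (hB : ∀ n, HasOpDeriv (fun σ => PowerSeries.coeff n (G σ))
      (fun σ v => PowerSeries.coeff n (B σ v)))
    (V : SmoothVectorField F T) (f : FormalSection F T E M) (σ : T) :
    (hG.act f).deriv V σ = formalAction (B σ (V σ)) (f σ) + formalAction (G σ) (f.deriv V σ) := by
  ext n x
  have hcoeff : ∀ k l, mvfderiv 𝓘(ℝ, F)
      (fun τ => (PowerSeries.coeff k (G τ) (PowerSeries.coeff l (f τ)) : M → ℂ) x) σ (V σ) =
      (PowerSeries.coeff k (B σ (V σ)) (PowerSeries.coeff l (f σ)) +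
        PowerSeries.coeff k (G σ) (PowerSeries.coeff l (f.deriv V σ)) : SmoothFun E M).1 x :=
    fun k l => by
      rw [(hG k).mvfderiv_apply (f.smooth l) V σ x, (hB k _ x).mvfderiv_apply,
        FormalSection.deriv, PowerSeries.coeff_mk]
      rfl
  rw [FormalSection.coeff_deriv_apply]
  simp only [act_apply, coeff_formalAction, map_add, ← Finset.sum_add_distrib]
  rw [mvfderiv_sum_apply _ fun p : ℕ × ℕ => (hG p.1).smooth (f.smooth p.2)]
  simp only [hcoeff, AddSubmonoidClass.coe_finsetSum, Finset.sum_apply]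

end IsSmoothFormalOpFamily

end FormalFamilies

/-! ### The transport equation -/

section Transport

theorem exists_seq_of_forall_lt {X : Type*} [Nonempty X] (r : ∀ n : ℕ, (∀ m < n, X) → X → Prop)
    (hex : ∀ (n : ℕ) (a : ℕ → X), (∀ m < n, r m (fun k _ => a k) (a m)) →
      ∃ x, r n (fun k _ => a k) x) :
    ∃ a : ℕ → X, ∀ n, r n (fun k _ => a k) (a n) := by
  let a : ℕ → X := fun n =>
    Nat.strongRec (motive := fun _ => X) (fun n prev => Classical.epsilon (r n prev)) n
  have ha : ∀ n, a n = Classical.epsilon (r n fun k _ => a k) := fun n => Nat.strongRec_eq _ n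
  refine ⟨a, fun n => ?_⟩
  induction n using Nat.strong_induction_on with
  | _ n ih =>
    rw [ha]
    exact Classical.epsilon_spec (hex n a ih)

variable {F : Type*} [NormedAddCommGroup F] [NormedSpace ℝ F]
  {T : Type*} [TopologicalSpace T] [ChartedSpace F T] [IsManifold 𝓘(ℝ, F) ∞ T]
  {E : Type*} [NormedAddCommGroup E] [NormedSpace ℝ E]
  {M : Type*} [TopologicalSpace M] [ChartedSpace E M]

namespace FormalConnection

variable (D : FormalConnection F T E M) {G H : T → PowerSeries (Module.End ℂ (SmoothFun E M))}
  {n : ℕ}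

/-- The right-hand side `-A G` of the transport equation `dG = -A G`, whose solutions carry
constant sections to parallel sections. -/
def transportForm (G : T → PowerSeries (Module.End ℂ (SmoothFun E M))) (σ : T)
    (v : TangentSpace 𝓘(ℝ, F) σ) : PowerSeries (Module.End ℂ (SmoothFun E M)) :=
  -(PowerSeries.mk (D.A σ v) * G σ)

theorem coeff_transportForm (G : T → PowerSeries (Module.End ℂ (SmoothFun E M))) (n : ℕ) (σ : T)
    (v : TangentSpace 𝓘(ℝ, F) σ) : PowerSeries.coeff n (D.transportForm G σ v) =
      -∑ p ∈ Finset.HasAntidiagonal.antidiagonal n, D.A σ v p.1 * PowerSeries.coeff p.2 (G σ) := by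
  simp only [transportForm, map_neg, PowerSeries.coeff_mul, PowerSeries.coeff_mk]

theorem coeff_transportForm_congr {σ : T}
    (h : ∀ m < n, PowerSeries.coeff m (G σ) = PowerSeries.coeff m (H σ))
    (v : TangentSpace 𝓘(ℝ, F) σ) : PowerSeries.coeff n (D.transportForm G σ v) =
      PowerSeries.coeff n (D.transportForm H σ v) := by
  rw [coeff_transportForm, coeff_transportForm]
  refine congrArg _ (Finset.sum_congr rfl fun p hp => ?_)
  rw [Finset.HasAntidiagonal.mem_antidiagonal] at hp
  by_cases hp_zero : p.1 = 0
  · rw [hp_zero, D.A_zero, zero_mul, zero_mul]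
  · rw [h p.2 (by lia)]

theorem isLinearMap_coeff_transportForm (G : T → PowerSeries (Module.End ℂ (SmoothFun E M)))
    (n : ℕ) (σ : T) : IsLinearMap ℝ fun v => PowerSeries.coeff n (D.transportForm G σ v) where
  map_add v w := by
    simp only [coeff_transportForm, map_add, Pi.add_apply, add_mul, Finset.sum_add_distrib]
    exact neg_add (α := Module.End ℂ (SmoothFun E M)) _ _
  map_smul c v := by
    simp only [coeff_transportForm, map_smul, Pi.smul_apply, smul_mul_assoc, ← Finset.smul_sum]
    exact (smul_neg (A := Module.End ℂ (SmoothFun E M)) c _).symm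

theorem coeff_transportForm_order (hG : IsSmoothFormalOpFamily F G) (n : ℕ) (σ₀ : T) :
    ∃ N : ℕ, ∀ᶠ σ in 𝓝 σ₀, ∀ v,
      PowerSeries.coeff n (D.transportForm G σ v) ∈ diffOpLT ℂ (SmoothFun E M) N := by
  choose k hA using fun i => D.isDiffOp i σ₀
  choose l hl using fun j => (hG j).order σ₀
  let N : ℕ × ℕ → ℕ := fun p => k p.1 + 1 + l p.2
  refine ⟨(Finset.HasAntidiagonal.antidiagonal n).sup N, ?_⟩
  filter_upwards [(Finset.HasAntidiagonal.antidiagonal n).eventually_all.2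
    fun p _ => (hA p.1).and (hl p.2)] with σ hσ v
  rw [coeff_transportForm]
  refine neg_mem (sum_mem fun p hp => diffOpLT_mono _ _ (Finset.le_sup (f := N) hp) ?_)
  exact mul_mem_diffOpLT (isDiffOp_iff_mem_diffOpLT.1 ((hσ p hp).1 v)) (hσ p hp).2

theorem isSmoothFamily_coeff_transportForm (hG : IsSmoothFormalOpFamily F G) (n : ℕ)
    (V : SmoothVectorField F T) (g : SmoothFun E M) :
    IsSmoothFamily F (fun σ => PowerSeries.coeff n (D.transportForm G σ (V σ)) g) := by
  simp only [coeff_transportForm, LinearMap.neg_apply, LinearMap.sum_apply, Module.End.mul_apply]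
  exact (isSmoothFamily_sum _ fun p _ => D.smooth p.1 V _ ((hG p.2).smooth_const g)).neg

variable {D}

/-- A trivialisation of `D` over the components of `T`: a solution of the transport equation
`dG = -A G` that is the identity at the base points. -/
structure IsTrivialisation (D : FormalConnection F T E M)
    (G : T → PowerSeries (Module.End ℂ (SmoothFun E M))) : Prop where
  smooth : IsSmoothFormalOpFamily F G
  transport : ∀ n, HasOpDeriv (fun σ => PowerSeries.coeff n (G σ))
    (fun σ v => PowerSeries.coeff n (D.transportForm G σ v))
  basePoint_eq_one : ∀ σ, G (basePoint σ) = 1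

theorem IsTrivialisation.coeff_zero [FiniteDimensional ℝ F] [T2Space T] (hG : D.IsTrivialisation G)
    (σ : T) : PowerSeries.coeff 0 (G σ) = 1 := by
  ext g x
  refine (hG.transport 0 g x).eq_of_basePoint (q := fun _ => (g : M → ℂ) x) ?_ (fun τ => ?_) σ
  · have hzero : ∀ τ v, PowerSeries.coeff 0 (D.transportForm G τ v) = 0 := fun τ v => by
      simp only [coeff_transportForm, Finset.Nat.antidiagonal_zero, Finset.sum_singleton,
        D.A_zero, zero_mul]
      exact neg_zero (G := Module.End ℂ (SmoothFun E M))
    simp only [hzero]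
    exact .const _
  · simp only [hG.basePoint_eq_one, PowerSeries.coeff_zero_one]
    rfl

variable [IsManifold 𝓘(ℝ, E) ∞ M]

theorem coeff_covDeriv_apply (W : SmoothVectorField F T) (s : FormalSection F T E M) (n : ℕ)
    (σ : T) (x : M) : ((PowerSeries.coeff n (D.covDeriv W s σ) : SmoothFun E M) : M → ℂ) x =
      mvfderiv 𝓘(ℝ, F) (fun τ => ((PowerSeries.coeff n (s τ) : SmoothFun E M) : M → ℂ) x) σ (W σ) +
        ((∑ p ∈ Finset.HasAntidiagonal.antidiagonal n,
          D.A σ (W σ) p.1 (PowerSeries.coeff p.2 (s σ)) : SmoothFun E M) : M → ℂ) x := by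
  rw [← FormalSection.coeff_deriv_apply, covDeriv_apply, map_add, coeff_formalAction]
  simp only [PowerSeries.coeff_mk]
  rfl

/- Modulo `h ^ (n + 1)` the connection form acts as zero on multiples of `h ^ n`, so there the
connection agrees with the trivial one. -/
theorem coeff_covDeriv_apply_of_forall_lt {s : FormalSection F T E M} {σ : T}
    (hs : ∀ k < n, PowerSeries.coeff k (s σ) = 0) (W : SmoothVectorField F T) (x : M) :
    ((PowerSeries.coeff n (D.covDeriv W s σ) : SmoothFun E M) : M → ℂ) x = mvfderiv 𝓘(ℝ, F)
      (fun τ => ((PowerSeries.coeff n (s τ) : SmoothFun E M) : M → ℂ) x) σ (W σ) := by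
  rw [coeff_covDeriv_apply, Finset.sum_eq_zero fun p hp => ?_]
  · exact add_zero _
  · rw [Finset.HasAntidiagonal.mem_antidiagonal] at hp
    by_cases hp_zero : p.1 = 0
    · rw [hp_zero, D.A_zero]
      rfl
    · rw [hs p.2 (by lia), map_zero]

variable [FiniteDimensional ℝ F]

theorem IsFlat.coeff_covDeriv_closed (hD : D.IsFlat) {s : FormalSection F T E M}
    (hs : ∀ (W : SmoothVectorField F T), ∀ k < n, ∀ σ, PowerSeries.coeff k (D.covDeriv W s σ) = 0)
    (V W : SmoothVectorField F T) (x : M) (σ : T) :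
    mvfderiv 𝓘(ℝ, F)
        (fun τ => ((PowerSeries.coeff n (D.covDeriv W s τ) : SmoothFun E M) : M → ℂ) x) σ (V σ)
      - mvfderiv 𝓘(ℝ, F)
        (fun τ => ((PowerSeries.coeff n (D.covDeriv V s τ) : SmoothFun E M) : M → ℂ) x) σ (W σ)
      - ((PowerSeries.coeff n (D.covDeriv (V.bracket W) s σ) : SmoothFun E M) : M → ℂ) x = 0 := by
  rw [← coeff_covDeriv_apply_of_forall_lt (D := D) (fun k hk => hs W k hk σ) V x,
    ← coeff_covDeriv_apply_of_forall_lt (D := D) (fun k hk => hs V k hk σ) W x]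
  have hflat := congrArg (PowerSeries.coeff n) (hD V W s σ)
  rw [map_sub, map_sub, map_zero] at hflat
  exact congrArg (fun f : SmoothFun E M => (f : M → ℂ) x) hflat

variable [T2Space T] [FiniteDimensional ℝ E] [T2Space M]

/- The form measures the failure of `G g`, which is parallel modulo `h ^ n`, to be parallel modulo
`h ^ (n + 1)`. -/
theorem IsFlat.isClosedOpForm_transportForm (hD : D.IsFlat) (hG : IsSmoothFormalOpFamily F G)
    (hG_transport : ∀ m < n, HasOpDeriv (fun σ => PowerSeries.coeff m (G σ))
      (fun σ v => PowerSeries.coeff m (D.transportForm G σ v)))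
    (hG_zero : ∀ σ, PowerSeries.coeff n (G σ) = 0) :
    IsClosedOpForm (fun σ v => PowerSeries.coeff n (D.transportForm G σ v)) where
  linear := D.isLinearMap_coeff_transportForm G n
  order := D.coeff_transportForm_order hG n
  smooth := D.isSmoothFamily_coeff_transportForm hG n
  closed V W g x σ := by
    let s : FormalSection F T E M := hG.act (.const F T (PowerSeries.C g))
    have hs : ∀ k τ, PowerSeries.coeff k (s τ) = PowerSeries.coeff k (G τ) g := fun k τ =>
      coeff_formalAction_C (G τ) g k
    have hDs : ∀ (U : SmoothVectorField F T) (k : ℕ) (τ : T) (y : M),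
        ((PowerSeries.coeff k (D.covDeriv U s τ) : SmoothFun E M) : M → ℂ) y =
          mvfderiv 𝓘(ℝ, F) (fun τ => (PowerSeries.coeff k (G τ) g : M → ℂ) y) τ (U τ)
            - (PowerSeries.coeff k (D.transportForm G τ (U τ)) g : M → ℂ) y := fun U k τ y => by
      rw [coeff_covDeriv_apply, coeff_transportForm]
      simp only [hs, LinearMap.neg_apply, LinearMap.sum_apply, Module.End.mul_apply]
      exact (sub_neg_eq_add _ _).symm
    have hDs_lt : ∀ U : SmoothVectorField F T, ∀ k < n, ∀ τ,
        PowerSeries.coeff k (D.covDeriv U s τ) = 0 := fun U k hk τ => by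
      ext y
      rw [hDs, (hG_transport k hk g y).mvfderiv_apply]
      exact sub_self _
    have hDs_n : ∀ (U : SmoothVectorField F T) (τ : T),
        ((PowerSeries.coeff n (D.covDeriv U s τ) : SmoothFun E M) : M → ℂ) x =
          -(PowerSeries.coeff n (D.transportForm G τ (U τ)) g : M → ℂ) x := fun U τ => by
      rw [hDs]
      simp only [hG_zero]
      exact (congrArg (· - _) ((IsPrimitive.const 0).mvfderiv_apply τ (U τ))).trans (zero_sub _)
    have hclosed := hD.coeff_covDeriv_closed hDs_lt V W x σ
    simp only [hDs_n] at hclosed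
    have hneg : ∀ U U' : SmoothVectorField F T, mvfderiv 𝓘(ℝ, F)
        (fun τ => -(PowerSeries.coeff n (D.transportForm G τ (U τ)) g : M → ℂ) x) σ (U' σ) =
          -mvfderiv 𝓘(ℝ, F)
            (fun τ => (PowerSeries.coeff n (D.transportForm G τ (U τ)) g : M → ℂ) x) σ (U' σ) :=
      fun U U' => congrArg (fun L : TangentSpace 𝓘(ℝ, F) σ →L[ℝ] ℂ => L (U' σ)) mvfderiv_neg
    rw [hneg, hneg] at hclosed
    linear_combination -hclosed

theorem IsFlat.exists_transport_coeff (hT : Subsingleton (deRhamH1 F T)) (hD : D.IsFlat)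
    (hG : ∀ m < n, IsSmoothOpFamily F fun σ => PowerSeries.coeff m (G σ))
    (hG_transport : ∀ m < n, HasOpDeriv (fun σ => PowerSeries.coeff m (G σ))
      (fun σ v => PowerSeries.coeff m (D.transportForm G σ v)))
    {P₀ : Module.End ℂ (SmoothFun E M)} {N : ℕ} (hP₀ : P₀ ∈ diffOpLT ℂ (SmoothFun E M) N) :
    ∃ Q : T → Module.End ℂ (SmoothFun E M), IsSmoothOpFamily F Q ∧
      HasOpDeriv Q (fun σ v => PowerSeries.coeff n (D.transportForm G σ v)) ∧
      ∀ σ, Q (basePoint σ) = P₀ := by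
  let H : T → PowerSeries (Module.End ℂ (SmoothFun E M)) := fun σ =>
    PowerSeries.mk fun m => if m < n then PowerSeries.coeff m (G σ) else 0
  have hH_lt : ∀ m < n, ∀ σ, PowerSeries.coeff m (H σ) = PowerSeries.coeff m (G σ) :=
    fun m hm σ => by simp [H, hm]
  have hH_ge : ∀ m, n ≤ m → ∀ σ, PowerSeries.coeff m (H σ) = 0 :=
    fun m hm σ => by simp [H, hm]
  have hH_transport : ∀ m ≤ n, ∀ σ v, PowerSeries.coeff m (D.transportForm H σ v) =
      PowerSeries.coeff m (D.transportForm G σ v) := fun m hm σ v =>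
    D.coeff_transportForm_congr (fun k hk => hH_lt k (hk.trans_le hm) σ) v
  have hH : IsSmoothFormalOpFamily F H := fun m => by
    rcases lt_or_ge m n with hm | hm
    · simpa only [hH_lt m hm] using hG m hm
    · simpa only [hH_ge m hm] using .const (zero_mem (diffOpLT ℂ (SmoothFun E M) 0))
  have hclosed := hD.isClosedOpForm_transportForm hH (fun m hm => by
    simpa only [hH_lt m hm, hH_transport m hm.le] using hG_transport m hm) (hH_ge n le_rfl)
  simp only [hH_transport n le_rfl] at hclosed
  exact hclosed.exists_isSmoothOpFamily hT hP₀

theorem IsFlat.exists_isTrivialisation (hT : Subsingleton (deRhamH1 F T)) (hD : D.IsFlat) :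
    ∃ G, D.IsTrivialisation G := by
  let series : ∀ n : ℕ, (∀ m < n, T → Module.End ℂ (SmoothFun E M)) →
      T → PowerSeries (Module.End ℂ (SmoothFun E M)) := fun n a σ =>
    PowerSeries.mk fun m => if hm : m < n then a m hm σ else 0
  have hseries : ∀ (a : ℕ → T → Module.End ℂ (SmoothFun E M)) (n : ℕ) (σ : T)
      (v : TangentSpace 𝓘(ℝ, F) σ),
      PowerSeries.coeff n (D.transportForm (series n fun k _ => a k) σ v) =
        PowerSeries.coeff n (D.transportForm (fun σ => PowerSeries.mk fun m => a m σ) σ v) :=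
    fun a n σ v => D.coeff_transportForm_congr (fun m hm => by simp [series, hm]) v
  obtain ⟨a, ha⟩ := exists_seq_of_forall_lt (X := T → Module.End ℂ (SmoothFun E M))
    (fun n a Q => IsSmoothOpFamily F Q ∧
      HasOpDeriv Q (fun σ v => PowerSeries.coeff n (D.transportForm (series n a) σ v)) ∧
      ∀ σ, Q (basePoint σ) = PowerSeries.coeff n 1) fun n a ha => by
    simp only [hseries] at ha ⊢
    refine hD.exists_transport_coeff hT (N := 1) (fun m hm => ?_) (fun m hm => ?_) ?_
    · simpa only [PowerSeries.coeff_mk] using (ha m hm).1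
    · simpa only [PowerSeries.coeff_mk] using (ha m hm).2.1
    · rw [PowerSeries.coeff_one]
      split_ifs
      exacts [one_mem_diffOpLT_one, zero_mem _]
  simp only [hseries] at ha
  refine ⟨fun σ => PowerSeries.mk fun m => a m σ, fun n => ?_, fun n => ?_, fun σ => ?_⟩
  · simpa only [PowerSeries.coeff_mk] using (ha n).1
  · simpa only [PowerSeries.coeff_mk] using (ha n).2.1
  · ext1 n
    simpa only [PowerSeries.coeff_mk] using (ha n).2.2 σ

end FormalConnection

end Transport

/-! ### Uniqueness up to gauge equivalence -/

section Gauge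

variable {F : Type*} [NormedAddCommGroup F] [NormedSpace ℝ F] [FiniteDimensional ℝ F]
  {T : Type*} [TopologicalSpace T] [T2Space T] [ChartedSpace F T] [IsManifold 𝓘(ℝ, F) ∞ T]
  {E : Type*} [NormedAddCommGroup E] [NormedSpace ℝ E]
  {M : Type*} [TopologicalSpace M] [ChartedSpace E M] [IsManifold 𝓘(ℝ, E) ∞ M]

theorem FormalSection.eq_basePoint_of_deriv_eq_zero {f : FormalSection F T E M}
    (hf : ∀ V σ, f.deriv V σ = 0) (σ : T) : f σ = f (basePoint σ) := by
  ext n x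
  refine eq_basePoint_of_mvfderiv_eq_zero (F := F)
    (h := fun τ => ((PowerSeries.coeff n (f τ) : SmoothFun E M) : M → ℂ) x)
    ((f.smooth n).mdifferentiable x) (fun τ v => ?_) σ
  obtain ⟨V, rfl⟩ := exists_vectorField_apply_eq v
  rw [← coeff_deriv_apply, hf]
  rfl

variable [FiniteDimensional ℝ E] [T2Space M]

namespace FormalConnection.IsTrivialisation

variable {D D' : FormalConnection F T E M} {G G' : T → PowerSeries (Module.End ℂ (SmoothFun E M))}

theorem covDeriv_act (hG : D.IsTrivialisation G) (V : SmoothVectorField F T)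
    (f : FormalSection F T E M) (σ : T) :
    D.covDeriv V (hG.smooth.act f) σ = formalAction (G σ) (f.deriv V σ) := by
  rw [covDeriv_apply, hG.smooth.deriv_act hG.transport, transportForm, formalAction_neg,
    formalAction_mul, IsSmoothFormalOpFamily.act_apply]
  abel

theorem act_act_invOfUnit (hG : D.IsTrivialisation G) (f : FormalSection F T E M) :
    hG.smooth.act (hG.smooth.invOfUnit_one.act f) = f :=
  FormalSection.ext_apply fun σ => formalAction_formalAction_invOfUnit (hG.coeff_zero σ) (f σ)

theorem act_invOfUnit_act (hG : D.IsTrivialisation G) (f : FormalSection F T E M) :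
    hG.smooth.invOfUnit_one.act (hG.smooth.act f) = f :=
  FormalSection.ext_apply fun σ => formalAction_invOfUnit_formalAction (hG.coeff_zero σ) (f σ)

theorem covDeriv_eq (hG : D.IsTrivialisation G) (V : SmoothVectorField F T)
    (f : FormalSection F T E M) (σ : T) : D.covDeriv V f σ =
      formalAction (G σ) ((hG.smooth.invOfUnit_one.act f).deriv V σ) := by
  rw [← hG.covDeriv_act, hG.act_act_invOfUnit]

theorem eq_of_covDeriv_eq_zero (hG : D.IsTrivialisation G) {f : FormalSection F T E M}
    (hf : ∀ V σ, D.covDeriv V f σ = 0) (σ : T) :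
    f σ = formalAction (G σ) (f (basePoint σ)) := by
  let u : FormalSection F T E M := hG.smooth.invOfUnit_one.act f
  have hu : ∀ τ, f τ = formalAction (G τ) (u τ) := fun τ =>
    (formalAction_formalAction_invOfUnit (hG.coeff_zero τ) (f τ)).symm
  have hu_deriv : ∀ V τ, u.deriv V τ = 0 := fun V τ => by
    rw [← formalAction_invOfUnit_formalAction (hG.coeff_zero τ) (u.deriv V τ),
      ← hG.covDeriv_eq, hf, map_zero]
  rw [hu, hu (basePoint σ), hG.basePoint_eq_one, formalAction_one,
    FormalSection.eq_basePoint_of_deriv_eq_zero hu_deriv σ]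

variable {Ω : SymplecticForm E M} {star : T → StarProduct Ω}

theorem mul_formalAction (hG : D.IsTrivialisation G) (hD : D.IsCompatible star) (σ : T)
    (f g : FormalFun E M) :
    (star σ).mul (formalAction (G σ) f) (formalAction (G σ) g) =
      formalAction (G σ) ((star (basePoint σ)).mul f g) := by
  let s : FormalFun E M → FormalSection F T E M := fun f => hG.smooth.act (.const F T f)
  have hs_parallel : ∀ f V τ, D.covDeriv V (s f) τ = 0 := fun f V τ => by
    rw [hG.covDeriv_act, FormalSection.deriv_const, map_zero]
  have hs_basePoint : ∀ f, s f (basePoint σ) = f := fun f => by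
    rw [IsSmoothFormalOpFamily.act_apply, hG.basePoint_eq_one, formalAction_one]
    rfl
  obtain ⟨p, hp, hp_covDeriv⟩ := hD (s f) (s g)
  have hp_parallel : ∀ V τ, D.covDeriv V p τ = 0 := fun V τ => by
    rw [hp_covDeriv, hs_parallel, hs_parallel]
    ext
    simp [StarProduct.mul, formalMul]
  have hpσ := hG.eq_of_covDeriv_eq_zero hp_parallel σ
  rw [hp, hp, hs_basePoint, hs_basePoint] at hpσ
  exact hpσ

theorem mul_formalAction_invOfUnit (hG : D.IsTrivialisation G) (hD : D.IsCompatible star) (σ : T)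
    (f g : FormalFun E M) :
    (star (basePoint σ)).mul (formalAction ((G σ).invOfUnit 1) f)
      (formalAction ((G σ).invOfUnit 1) g) =
      formalAction ((G σ).invOfUnit 1) ((star σ).mul f g) := by
  have hinv := formalAction_formalAction_invOfUnit (hG.coeff_zero σ)
  rw [← formalAction_invOfUnit_formalAction (hG.coeff_zero σ) ((star (basePoint σ)).mul _ _),
    ← hG.mul_formalAction hD, hinv, hinv]

/-- The self-equivalence `G G'⁻¹` obtained by comparing trivialisations `G` of `D` and `G'` of
`D'`. -/
def selfEquivalence (hG : D.IsTrivialisation G) (hG' : D'.IsTrivialisation G')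
    (hD : D.IsCompatible star) (hD' : D'.IsCompatible star) : SelfEquivalence F star where
  P σ n := PowerSeries.coeff n (G σ * (G' σ).invOfUnit 1)
  P_zero σ := by
    rw [PowerSeries.coeff_mul, Finset.Nat.antidiagonal_zero, Finset.sum_singleton, hG.coeff_zero,
      one_mul]
    exact (PowerSeries.coeff_zero_eq_constantCoeff_apply _).trans
      (PowerSeries.constantCoeff_invOfUnit (G' σ) 1)
  isDiffOp k σ₀ := by
    obtain ⟨N, hN⟩ := (hG.smooth.mul hG'.smooth.invOfUnit_one k).order σ₀
    exact ⟨N, hN.mono fun σ hσ =>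
      isDiffOp_iff_mem_diffOpLT.2 (diffOpLT_mono _ _ N.le_succ hσ)⟩
  smooth k f hf := (hG.smooth.mul hG'.smooth.invOfUnit_one k).smooth hf
  map_mul σ f g := by
    simp only [formalApply_coeff, formalAction_mul]
    rw [hG.mul_formalAction hD, hG'.mul_formalAction_invOfUnit hD']

theorem selfEquivalence_apply (hG : D.IsTrivialisation G) (hG' : D'.IsTrivialisation G')
    (hD : D.IsCompatible star) (hD' : D'.IsCompatible star) (f : FormalSection F T E M) :
    (hG.selfEquivalence hG' hD hD').apply f =
      hG.smooth.act (hG'.smooth.invOfUnit_one.act f) :=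
  FormalSection.ext_apply fun σ => by
    refine (formalApply_coeff _ _).trans ?_
    rw [formalAction_mul]
    rfl

theorem gaugeEquivalent (hG : D.IsTrivialisation G) (hG' : D'.IsTrivialisation G')
    (hD : D.IsCompatible star) (hD' : D'.IsCompatible star) : GaugeEquivalent star D D' := by
  let Pinv : FormalSection F T E M → FormalSection F T E M := fun f =>
    hG'.smooth.act (hG.smooth.invOfUnit_one.act f)
  have hPinv : ∀ f σ, Pinv f σ = formalAction (G' σ) (formalAction ((G σ).invOfUnit 1) (f σ)) :=
    fun _ _ => rfl
  refine ⟨hG.selfEquivalence hG' hD hD', Pinv, fun f => ?_, fun f => ?_,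
    fun V f => FormalSection.ext_apply fun σ => ?_⟩
  · simp only [Pinv, selfEquivalence_apply, hG.act_invOfUnit_act, hG'.act_act_invOfUnit]
  · simp only [Pinv, selfEquivalence_apply, hG'.act_invOfUnit_act, hG.act_act_invOfUnit]
  · rw [hPinv, hG.selfEquivalence_apply, hG.covDeriv_act,
      formalAction_invOfUnit_formalAction (hG.coeff_zero σ), hG'.covDeriv_eq]

end FormalConnection.IsTrivialisation

end Gauge

end

end FormalHitchin

theorem mainTheorem6_general
    {F : Type*} [NormedAddCommGroup F] [NormedSpace ℝ F] [FiniteDimensional ℝ F]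
    {T : Type*} [TopologicalSpace T] [T2Space T] [ChartedSpace F T] [IsManifold 𝓘(ℝ, F) ∞ T]
    {E : Type*} [NormedAddCommGroup E] [NormedSpace ℝ E] [FiniteDimensional ℝ E]
    {M : Type*} [TopologicalSpace M] [T2Space M] [ChartedSpace E M] [IsManifold 𝓘(ℝ, E) ∞ M]
    {Ω : FormalHitchin.SymplecticForm E M} (hT : Subsingleton (FormalHitchin.deRhamH1 F T))
    (star : T → FormalHitchin.StarProduct Ω) {D D' : FormalHitchin.FormalConnection F T E M}
    (hD : D.IsFlatCompatible star) (hD' : D'.IsFlatCompatible star) :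
    FormalHitchin.GaugeEquivalent star D D' := by
  obtain ⟨G, hG⟩ := hD.isFlat.exists_isTrivialisation hT
  obtain ⟨G', hG'⟩ := hD'.isFlat.exists_isTrivialisation hT
  exact hG.gaugeEquivalent hG' hD.isCompatible hD'.isCompatible

theorem mainTheorem6 {n : ℕ}
    -- the compact symplectic manifold `(M, Ω)` of dimension `2 n`
    {M : Type*} [TopologicalSpace M] [T2Space M] [CompactSpace M]
    [ChartedSpace (EuclideanSpace ℝ (Fin (2 * n))) M] [IsManifold (𝓡 (2 * n)) ∞ M]
    [MeasurableSpace M] [BorelSpace M]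
    (Ω : FormalHitchin.SymplecticForm (EuclideanSpace ℝ (Fin (2 * n))) M)
    -- a prequantum line bundle
    {ι : Type*} (L : FormalHitchin.PrequantumBundle Ω ι)
    -- the parameter manifold `T`, with `H¹(T, ℝ) = 0`
    {F : Type*} [NormedAddCommGroup F] [NormedSpace ℝ F] [FiniteDimensional ℝ F]
    {T : Type*} [TopologicalSpace T] [T2Space T] [SecondCountableTopology T]
    [ChartedSpace F T] [IsManifold 𝓘(ℝ, F) ∞ T]
    (hT : Subsingleton (FormalHitchin.deRhamH1 F T))
    -- the family of Kähler structures and its family of Berezin-Toeplitz star products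
    (K : FormalHitchin.KahlerFamily Ω F T) (star : T → FormalHitchin.StarProduct Ω)
    (hstar : ∀ σ, L.IsBerezinToeplitz (K.J σ) (star σ))
    -- two formal Hitchin connections
    (D D' : FormalHitchin.FormalConnection F T (EuclideanSpace ℝ (Fin (2 * n))) M)
    (hD : D.IsFlatCompatible star)
    (hD' : D'.IsFlatCompatible star) :
    FormalHitchin.GaugeEquivalent star D D' :=
  mainTheorem6_general hT star hD hD'
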